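/- Let $r,s:\mathbb Z\to\mathbb R$ satisfy $r(0)=s(0)=1$ and $s\in\ell^2(\mathbb Z)$, let $\mathfrak H$ be a real separable Hilbert space containing a family $\{e_{ij}\}_{i,j\ge1}$ with $\langle e_{ij},e_{i'j'}\rangle=r(i-i')\,s(j-j')$, and let $X=\{X(h)\}_{h\in\mathfrak H}$ be an isonormal process over $\mathfrak H$, i.e. a centered Gaussian process with $\mathbb E[X(g)X(h)]=\langle g,h\rangle$. Put $X_{ij}=X(e_{ij})$ and, for $n,d\ge1$, let $\widetilde{\mathcal W}_{n,d}$ be the shifted Wishart matrix with entries $$\widetilde W_{ij}=\frac1{\sqrt d}\sum_{k=1}^d\big(X_{ik}X_{jk}-r(i-j)\big),\qquad 1\le i,j\le n.$$ Let $\mathcal G^{(r,s)}_{n,d}$ be a random symmetric $n\times n$ matrix whose vector of $n^2$ entries is centered Gaussian with the same covariance matrix as the vector of entries of $\widetilde{\mathcal W}_{n,d}$. For random $n\times n$ real matrices $\mathcal X,\mathcal Y$ let $$d_{\rm Wass}(\mathcal X,\mathcal Y)=\sup_{\|g\|_{\rm Lip}\le1}\big(\mathbb E[g(\mathcal X)]-\mathbb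 E[g(\mathcal Y)]\big),\qquad d_{\rm FM}(\mathcal X,\mathcal Y)=\sup_{\|g\|_\infty+\|g\|_{\rm Lip}\le1}\big(\mathbb E[g(\mathcal X)]-\mathbb E[g(\mathcal Y)]\big),$$ where $\|\cdot\|_{\rm Lip}$ is the Lipschitz seminorm with respect to the Hilbert–Schmidt norm. Then there are an absolute constant $C$ and constants $C_2(r),C_1(r)$ depending only on $r$ such that, for all $n,d\ge1$, $$d_{\rm Wass}\big(\widetilde{\mathcal W}_{n,d},\mathcal G^{(r,s)}_{n,d}\big)\le\begin{cases}\displaystyle C\,\frac{n^{5/2}}{d^{1/4}}\Big(\sum_{|k|\le d}|s(k)|^{4/3}\Big)^{3/4};\\[2mm]\displaystyle C_2(r)\,\frac{n^{9/4}}{d^{1/4}}\Big(\sum_{|k|\le d}|s(k)|^{4/3}\Big)^{3/4}&\text{if in addition }r\in\ell^2(\mathbb Z);\\[2mm]\displaystyle C_1(r)\,\frac{n^{2}}{d^{1/4}}\Big(\sum_{|k|\le d}|s(k)|^{4/3}\Big)^{3/4}&\text{if in addition }r\in\ell^1(\mathbb Z).\end{cases}$$ In particular, if in addition $s\in\ell^{4/3}(\mathbb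 Z)$, then $\widetilde{\mathcal W}_{n,d}$ is $\phi$-close to $\mathcal G^{(r,s)}_{n,d}$, meaning that $d_{\rm FM}(\widetilde{\mathcal W}_{n,d},\mathcal G^{(r,s)}_{n,d})\to0$ when $n,d\to\infty$ and $\phi(n,d)\to0$, for $\phi(n,d)=n^{10}/d$; for $\phi(n,d)=n^9/d$ if moreover $r\in\ell^2(\mathbb Z)$; and for $\phi(n,d)=n^8/d$ if moreover $r\in\ell^1(\mathbb Z)$. -/

import Mathlib

open MeasureTheory ProbabilityTheory Filter Topology
open scoped ENNReal

namespace CorrelatedWishart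

/-- The Hilbert-Schmidt norm of a real matrix. -/
noncomputable def hsNorm {n : ℕ} (A : Matrix (Fin n) (Fin n) ℝ) : ℝ :=
  Real.sqrt (∑ i, ∑ j, A i j ^ 2)

/-- The supremum norm of a function on matrices (possibly infinite). -/
noncomputable def supNorm {n : ℕ} (g : Matrix (Fin n) (Fin n) ℝ → ℝ) : ℝ≥0∞ :=
  ⨆ A, ENNReal.ofReal |g A|

/-- The Lipschitz seminorm, with respect to the Hilbert-Schmidt norm, of a function on matrices
(possibly infinite). -/
noncomputable def lipNorm {n : ℕ} (g : Matrix (Fin n) (Fin n) ℝ → ℝ) : ℝ≥0∞ :=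
  ⨆ (A : Matrix (Fin n) (Fin n) ℝ) (B : Matrix (Fin n) (Fin n) ℝ) (_ : A ≠ B),
    ENNReal.ofReal (|g A - g B| / hsNorm (A - B))

/-- The Wasserstein distance between two random matrices, possibly defined on different
probability spaces. The class of test functions is stable under `g ↦ -g`, so that
the supremum is that of the nonnegative differences. -/
noncomputable def dWass {Ω Ω' : Type*} [MeasurableSpace Ω] [MeasurableSpace Ω'] {n : ℕ}
    (P : Measure Ω) (X : Ω → Matrix (Fin n) (Fin n) ℝ)
    (P' : Measure Ω') (Y : Ω' → Matrix (Fin n) (Fin n) ℝ) : ℝ≥0∞ :=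
  ⨆ (g : Matrix (Fin n) (Fin n) ℝ → ℝ) (_ : lipNorm g ≤ 1),
    ENNReal.ofReal ((∫ ω, g (X ω) ∂P) - ∫ ω, g (Y ω) ∂P')

/-- The Fortet-Mourier distance between two random matrices. -/
noncomputable def dFM {Ω Ω' : Type*} [MeasurableSpace Ω] [MeasurableSpace Ω'] {n : ℕ}
    (P : Measure Ω) (X : Ω → Matrix (Fin n) (Fin n) ℝ)
    (P' : Measure Ω') (Y : Ω' → Matrix (Fin n) (Fin n) ℝ) : ℝ≥0∞ :=
  ⨆ (g : Matrix (Fin n) (Fin n) ℝ → ℝ) (_ : supNorm g + lipNorm g ≤ 1),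
    ENNReal.ofReal ((∫ ω, g (X ω) ∂P) - ∫ ω, g (Y ω) ∂P')

/-- `W n d` is `φ`-close to `Z n d`: their Fortet-Mourier distance tends to zero when
`n, d → ∞` and `φ n d → 0`. -/
def PhiClose {Ω Ω' : Type*} [MeasurableSpace Ω] [MeasurableSpace Ω'] (φ : ℕ → ℕ → ℝ≥0∞)
    (P : Measure Ω) (W : (n d : ℕ) → Ω → Matrix (Fin n) (Fin n) ℝ)
    (P' : Measure Ω') (Z : (n d : ℕ) → Ω' → Matrix (Fin n) (Fin n) ℝ) : Prop :=
  Tendsto (fun p : ℕ × ℕ => dFM P (W p.1 p.2) P' (Z p.1 p.2))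
    ((atTop ×ˢ atTop) ⊓ comap (fun p : ℕ × ℕ => φ p.1 p.2) (𝓝 0)) (𝓝 0)

/-- `X` is an isonormal process over the real Hilbert space `H`: a centered Gaussian process
indexed by `H` with `𝔼[X(g) X(h)] = ⟨g, h⟩`. -/
structure IsIsonormal {H Ω : Type*} [NormedAddCommGroup H] [InnerProductSpace ℝ H]
    [MeasurableSpace Ω] (X : H → Ω → ℝ) (P : Measure Ω) : Prop where
  gaussian : IsGaussianProcess X P
  centered : ∀ h, ∫ ω, X h ω ∂P = 0
  covariance : ∀ g h, ∫ ω, X g ω * X h ω ∂P = inner ℝ g h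

/-- The shifted Wishart matrix, with entries `d^{-1/2} ∑_{k < d} (X_{ik} X_{jk} - r(i - j))`,
where `X_{ik} = X (e i k)`. Rows and columns are numbered from zero. -/
noncomputable def shiftedWishart {H Ω : Type*} (r : ℤ → ℝ) (e : ℕ → ℕ → H) (X : H → Ω → ℝ)
    (n d : ℕ) (ω : Ω) : Matrix (Fin n) (Fin n) ℝ :=
  Matrix.of fun i j =>
    1 / Real.sqrt d * ∑ k ∈ Finset.range d,
      (X (e i k) ω * X (e j k) ω - r ((i : ℤ) - (j : ℤ)))

/-- `G` is a random symmetric matrix whose vector of entries is centered Gaussian with the same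
covariance matrix as the vector of entries of the random matrix `W`. -/
structure IsGaussianCounterpart {Ω Ω' : Type*} [MeasurableSpace Ω] [MeasurableSpace Ω'] {n : ℕ}
    (P' : Measure Ω') (G : Ω' → Matrix (Fin n) (Fin n) ℝ)
    (P : Measure Ω) (W : Ω → Matrix (Fin n) (Fin n) ℝ) : Prop where
  symm : ∀ᵐ ω ∂P', (G ω).IsSymm
  gaussian : HasGaussianLaw (fun ω => fun p : Fin n × Fin n => G ω p.1 p.2) P'
  centered : ∀ i j, ∫ ω, G ω i j ∂P' = 0
  covariance : ∀ i j u v,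
    cov[fun ω => G ω i j, fun ω => G ω u v; P'] = cov[fun ω => W ω i j, fun ω => W ω u v; P]

/-- The quantity `n^a d^{-1/4} (∑_{|k| ≤ d} |s(k)|^{4/3})^{3/4}`. -/
noncomputable def rate (s : ℤ → ℝ) (a : ℝ) (n d : ℕ) : ℝ :=
  (n : ℝ) ^ a / (d : ℝ) ^ (1 / 4 : ℝ) *
    (∑ k ∈ Finset.Icc (-(d : ℤ)) (d : ℤ), |s k| ^ (4 / 3 : ℝ)) ^ (3 / 4 : ℝ)

end CorrelatedWishart

/-! The entries $X_{ik}$ form a Gaussian vector with covariance $R\otimes S$, and the Wishart matrix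
$w$ is a quadratic function of it. Gaussian integration by parts (`integral_dual_mul_eq`) therefore
yields a Stein kernel: $E[w_a h]=E[\partial_{\xi_a}h]$, where $T_a=Dw(\xi_a)$ fluctuates around row
$a$ of the covariance $c$ of $w$ (`integral_wishartMap_mul`, `fderiv_wishartMap_wishartField`).

The limit is degenerate, because entries $(i,j)$ and $(j,i)$ coincide, and test functions are only
Lipschitz. So an auxiliary standard Gaussian $z$ is added and one interpolates along $U_t=\sin
t\,w+\cos t\,y+\varepsilon z$, with $y$ the Gaussian limit. The $t$-derivative of $E\,g(U_t)$ is
$\sin t\cos t$ times the mean of $D^2g(U_t)$ paired with $T-c$. Integrating by parts in $z$ trades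
one derivative of $g$ for a factor $1/\varepsilon$. If $D$ bounds the $L^2$ size of $T-c$ and $m$ is
the square root of the dimension, the path costs at most a multiple of $mD/\varepsilon$ and the
noise costs $\varepsilon m$ at each end. The choice $\varepsilon=\sqrt D$ gives $4m\sqrt D$
(`abs_integral_sub_integral_le`); this square root is the origin of $d^{-1/4}$.

By Wick's formula, the variance of each entry of $T$ is a sum of $S$ over four-cycles.
`sum_cycle_le` bounds such a sum by $dA^3$ with $A=\sum_{|k|\le d}|s(k)|^{4/3}$. Since $|r|\le1$ on
the relevant indices, $n^4$ entries give $D^2\le 16n^4A^3/d$. With $m=n$ the bound is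
$8n^2A^{3/4}d^{-1/4}$. Larger exponents of $n\ge1$ follow, and when $A$ stays bounded the regimes
are read off from the fourth power of the bound. -/

namespace CorrelatedWishart

/-! ### Polynomial growth and Gaussian integration by parts. -/

section Growth

variable {E F G : Type*} [NormedAddCommGroup E] [NormedAddCommGroup F] [NormedAddCommGroup G]

/-- Functions of at most polynomial growth. -/
def PolyBounded (f : E → F) : Prop :=
  ∃ (C : ℝ) (m : ℕ), 0 ≤ C ∧ ∀ x, ‖f x‖ ≤ C * (1 + ‖x‖) ^ m

namespace PolyBounded

lemma of_le {f : E → F} {g : E → G} (hg : PolyBounded g) (h : ∀ x, ‖f x‖ ≤ ‖g x‖) :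
    PolyBounded f := by
  obtain ⟨C, m, hC, hb⟩ := hg
  exact ⟨C, m, hC, fun x => (h x).trans (hb x)⟩

lemma of_bounded {f : E → F} (C : ℝ) (h : ∀ x, ‖f x‖ ≤ C) : PolyBounded f :=
  ⟨C, 0, (norm_nonneg _).trans (h 0), fun x => by simpa using h x⟩

lemma const (c : F) : PolyBounded (fun _ : E => c) := of_bounded ‖c‖ fun _ => le_rfl

lemma id : PolyBounded (fun x : E => x) :=
  ⟨1, 1, zero_le_one, fun x => by simp⟩

lemma one_add_norm_pow_le (x : E) {m k : ℕ} (h : m ≤ k) : (1 + ‖x‖) ^ m ≤ (1 + ‖x‖) ^ k :=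
  pow_le_pow_right₀ (by linarith [norm_nonneg x]) h

lemma add {f g : E → F} (hf : PolyBounded f) (hg : PolyBounded g) :
    PolyBounded (fun x => f x + g x) := by
  obtain ⟨C, m, hC, hf⟩ := hf
  obtain ⟨D, k, hD, hg⟩ := hg
  refine ⟨C + D, max m k, by positivity, fun x => ?_⟩
  have h1 := one_add_norm_pow_le x (le_max_left m k)
  have h2 := one_add_norm_pow_le x (le_max_right m k)
  calc ‖f x + g x‖ ≤ C * (1 + ‖x‖) ^ m + D * (1 + ‖x‖) ^ k :=
        (norm_add_le _ _).trans (add_le_add (hf x) (hg x))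
    _ ≤ C * (1 + ‖x‖) ^ max m k + D * (1 + ‖x‖) ^ max m k := by gcongr
    _ = _ := by ring

lemma of_le_mul {f : E → F} {g : E → G} {A : Type*} [NormedAddCommGroup A] {k : E → A} (K : ℝ)
    (hK : 0 ≤ K) (hg : PolyBounded g) (hk : PolyBounded k)
    (h : ∀ x, ‖f x‖ ≤ K * (‖g x‖ * ‖k x‖)) : PolyBounded f := by
  obtain ⟨C, m, hC, hg⟩ := hg
  obtain ⟨D, l, hD, hk⟩ := hk
  refine ⟨K * (C * D), m + l, by positivity, fun x => ?_⟩
  calc ‖f x‖ ≤ K * (‖g x‖ * ‖k x‖) := h x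
    _ ≤ K * ((C * (1 + ‖x‖) ^ m) * (D * (1 + ‖x‖) ^ l)) := by
        gcongr
        · exact hg x
        · exact hk x
    _ = _ := by ring

lemma mul {f g : E → ℝ} (hf : PolyBounded f) (hg : PolyBounded g) :
    PolyBounded (fun x => f x * g x) :=
  of_le_mul 1 zero_le_one hf hg fun x => by simp

lemma norm {f : E → F} (hf : PolyBounded f) : PolyBounded (fun x => ‖f x‖) :=
  hf.of_le fun x => by simp

lemma pow {f : E → ℝ} (hf : PolyBounded f) (k : ℕ) : PolyBounded (fun x => f x ^ k) := by
  induction k with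
  | zero => simpa using const (1 : ℝ)
  | succ k ih => simpa [pow_succ] using ih.mul hf

lemma comp {f : F → G} {u : E → F} (hf : PolyBounded f) (hu : PolyBounded u) :
    PolyBounded (fun x => f (u x)) := by
  obtain ⟨C, m, hC, hf⟩ := hf
  obtain ⟨D, k, hD, hu⟩ := hu
  refine ⟨C * (1 + D) ^ m, k * m, by positivity, fun x => ?_⟩
  have h1 : 1 ≤ (1 + ‖x‖) ^ k := one_le_pow₀ (by linarith [norm_nonneg x])
  calc ‖f (u x)‖ ≤ C * (1 + ‖u x‖) ^ m := hf _
    _ ≤ C * ((1 + D) * (1 + ‖x‖) ^ k) ^ m := by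
        gcongr
        nlinarith [hu x]
    _ = _ := by rw [mul_pow, ← pow_mul]; ring

lemma clm [NormedSpace ℝ E] [NormedSpace ℝ F] (L : E →L[ℝ] F) : PolyBounded (fun x => L x) :=
  of_le_mul ‖L‖ (norm_nonneg L) (const (1 : ℝ)) id fun x => by simpa using L.le_opNorm x

lemma clm_apply [NormedSpace ℝ F] [NormedSpace ℝ G] {f : E → F →L[ℝ] G} {u : E → F}
    (hf : PolyBounded f) (hu : PolyBounded u) : PolyBounded (fun x => f x (u x)) :=
  of_le_mul 1 zero_le_one hf hu fun x => by simpa using (f x).le_opNorm (u x)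

lemma smul [NormedSpace ℝ F] {f : E → ℝ} {g : E → F} (hf : PolyBounded f) (hg : PolyBounded g) :
    PolyBounded (fun x => f x • g x) :=
  of_le_mul 1 zero_le_one hf hg fun x => by simp [norm_smul]

variable [NormedSpace ℝ E] [CompleteSpace E] [SecondCountableTopology E] [MeasurableSpace E]
  [BorelSpace E]

/-- Gaussian measures have finite moments of every order. -/
lemma integrable {μ : Measure E} [IsGaussian μ] {f : E → F} (hf : PolyBounded f)
    (hm : AEStronglyMeasurable f μ) : Integrable f μ := by
  obtain ⟨C, m, hC, hf⟩ := hf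
  have h1 : MemLp (fun x : E => 1 + ‖x‖) m μ :=
    (memLp_const (1 : ℝ)).add (IsGaussian.memLp_id μ m (by simp)).norm
  have h2 : Integrable (fun x : E => ‖1 + ‖x‖‖ ^ m) μ := h1.integrable_norm_pow'
  refine (h2.const_mul C).mono' hm (ae_of_all _ fun x => ?_)
  rw [Real.norm_of_nonneg (by positivity)]
  exact hf x

lemma integrable' {μ : Measure E} [IsGaussian μ] [SecondCountableTopologyEither E F]
    {f : E → F} (hf : PolyBounded f) (hc : Continuous f) : Integrable f μ :=
  hf.integrable hc.aestronglyMeasurable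

end PolyBounded

variable [NormedSpace ℝ E] [NormedSpace ℝ F] [NormedSpace ℝ G]

/-- Continuously differentiable functions which have at most polynomial growth together with
their derivative. -/
structure TemperedC1 (f : E → F) : Prop where
  contDiff : ContDiff ℝ 1 f
  growth : PolyBounded f
  growth_fderiv : PolyBounded (fderiv ℝ f)

namespace TemperedC1

lemma differentiable {f : E → F} (hf : TemperedC1 f) : Differentiable ℝ f :=
  hf.contDiff.differentiable one_ne_zero

lemma continuous {f : E → F} (hf : TemperedC1 f) : Continuous f := hf.contDiff.continuous

lemma continuous_fderiv {f : E → F} (hf : TemperedC1 f) : Continuous (fderiv ℝ f) :=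
  hf.contDiff.continuous_fderiv one_ne_zero

lemma const (c : F) : TemperedC1 (fun _ : E => c) :=
  ⟨contDiff_const, .const c, by
    rw [fderiv_fun_const]
    exact PolyBounded.const (0 : E →L[ℝ] F)⟩

lemma clm (L : E →L[ℝ] F) : TemperedC1 (fun x => L x) :=
  ⟨L.contDiff, .clm L, by
    rw [show fderiv ℝ (fun x => L x) = fun _ => L from funext fun x => L.fderiv]
    exact PolyBounded.const L⟩

lemma add {f g : E → F} (hf : TemperedC1 f) (hg : TemperedC1 g) :
    TemperedC1 (fun x => f x + g x) := by
  refine ⟨hf.contDiff.add hg.contDiff, hf.growth.add hg.growth, ?_⟩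
  have : fderiv ℝ (fun x => f x + g x) = fun x => fderiv ℝ f x + fderiv ℝ g x :=
    funext fun x => fderiv_fun_add (hf.differentiable x) (hg.differentiable x)
  rw [this]
  exact hf.growth_fderiv.add hg.growth_fderiv

lemma sum {ι : Type*} (s : Finset ι) {f : ι → E → F} (hf : ∀ i, TemperedC1 (f i)) :
    TemperedC1 (fun x => ∑ i ∈ s, f i x) := by
  classical
  induction s using Finset.induction_on with
  | empty => simpa using const (0 : F)
  | insert a s ha ih => simpa [Finset.sum_insert ha] using (hf a).add ih

lemma smul {f : E → ℝ} {g : E → F} (hf : TemperedC1 f) (hg : TemperedC1 g) :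
    TemperedC1 (fun x => f x • g x) := by
  refine ⟨hf.contDiff.smul hg.contDiff, hf.growth.smul hg.growth, ?_⟩
  have : fderiv ℝ (fun x => f x • g x) =
      fun x => f x • fderiv ℝ g x + (fderiv ℝ f x).smulRight (g x) :=
    funext fun x => fderiv_fun_smul (hf.differentiable x) (hg.differentiable x)
  rw [this]
  refine (hf.growth.smul hg.growth_fderiv).add ?_
  exact .of_le_mul 1 zero_le_one hf.growth_fderiv hg.growth fun x => by simp

lemma mul {f g : E → ℝ} (hf : TemperedC1 f) (hg : TemperedC1 g) :
    TemperedC1 (fun x => f x * g x) := hf.smul hg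

lemma const_smul {g : E → F} (hg : TemperedC1 g) (c : ℝ) : TemperedC1 (fun x => c • g x) :=
  (const c).smul hg

lemma const_mul {g : E → ℝ} (hg : TemperedC1 g) (c : ℝ) : TemperedC1 (fun x => c * g x) :=
  (const c).mul hg

lemma sub {f g : E → F} (hf : TemperedC1 f) (hg : TemperedC1 g) :
    TemperedC1 (fun x => f x - g x) := by
  simpa [sub_eq_add_neg] using hf.add (hg.const_smul (-1))

lemma comp {f : F → G} {u : E → F} (hf : TemperedC1 f) (hu : TemperedC1 u) :
    TemperedC1 (fun x => f (u x)) := by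
  refine ⟨hf.contDiff.comp hu.contDiff, hf.growth.comp hu.growth, ?_⟩
  have : fderiv ℝ (fun x => f (u x)) = fun x => (fderiv ℝ f (u x)).comp (fderiv ℝ u x) :=
    funext fun x => fderiv_fun_comp x (hf.differentiable _) (hu.differentiable x)
  rw [this]
  exact .of_le_mul 1 zero_le_one (hf.growth_fderiv.comp hu.growth) hu.growth_fderiv fun x => by
    simpa using ContinuousLinearMap.opNorm_comp_le _ _

lemma clm_comp (L : F →L[ℝ] G) {u : E → F} (hu : TemperedC1 u) : TemperedC1 (fun x => L (u x)) :=
  (clm L).comp hu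

end TemperedC1

/-- Differentiation of a parametric integral against a Gaussian measure, when the derivative of
the integrand has polynomial growth, uniformly in the parameter. -/
lemma hasDerivAt_integral_of_polyBounded [CompleteSpace E] [SecondCountableTopology E]
    [MeasurableSpace E] [BorelSpace E] {μ : Measure E} [IsGaussian μ]
    {k k' : ℝ → E → ℝ} {b : E → ℝ} (hk : ∀ t, Integrable (k t) μ)
    (hk' : ∀ t, Continuous (k' t)) (hb : PolyBounded b) (hbc : Continuous b)
    (hle : ∀ t x, ‖k' t x‖ ≤ b x) (hd : ∀ t x, HasDerivAt (fun t => k t x) (k' t x) t) (t : ℝ) :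
    HasDerivAt (fun t => ∫ x, k t x ∂μ) (∫ x, k' t x ∂μ) t :=
  (hasDerivAt_integral_of_dominated_loc_of_deriv_le (s := Set.univ) (bound := b) univ_mem
    (.of_forall fun t => (hk t).aestronglyMeasurable) (hk t) (hk' t).aestronglyMeasurable
    (ae_of_all _ fun x t _ => hle t x) (hb.integrable' hbc) (ae_of_all _ fun x t _ => hd t x)).2

/-- Gaussian integration by parts. -/
theorem integral_dual_mul_eq [CompleteSpace E] [SecondCountableTopology E]
    [MeasurableSpace E] [BorelSpace E] {μ : Measure E} [IsGaussian μ] (hμ : ∫ x, x ∂μ = 0)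
    (L : E →L[ℝ] ℝ) {h : E → ℝ} (hh : TemperedC1 h) :
    ∫ x, L x * h x ∂μ = ∫ x, fderiv ℝ h x (∫ z, L z • z ∂μ) ∂μ := by
  -- Rotation by the angle $t$ preserves $\mu\otimes\mu$ and sends $(x,y)$ to `(a t, a' t)`, so
  -- $E[h(a_t)L(a'_t)]$ does not depend on $t$. Its derivative at $t=0$ is
  -- $E[Dh(x)(y)\,L(y)]-E[L(x)h(x)]$, and it vanishes; integrating out $y$ gives the claim.
  let a : ℝ → E × E → E := fun t z => Real.cos t • z.1 + Real.sin t • z.2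
  let a' : ℝ → E × E → E := fun t z => -(Real.sin t) • z.1 + Real.cos t • z.2
  have hac : ∀ t, Continuous (a t) := fun t => by fun_prop
  have hac' : ∀ t, Continuous (a' t) := fun t => by fun_prop
  have ha : ∀ t z, HasDerivAt (fun t => a t z) (a' t z) t := fun t z =>
    ((Real.hasDerivAt_cos t).smul_const z.1).add ((Real.hasDerivAt_sin t).smul_const z.2)
  have ha' : ∀ t z, HasDerivAt (fun t => a' t z) (-a t z) t := fun t z => by
    have := ((Real.hasDerivAt_sin t).neg.smul_const z.1).add
      ((Real.hasDerivAt_cos t).smul_const z.2)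
    rw [show -a t z = -Real.cos t • z.1 + -Real.sin t • z.2 by simp only [a]; module]
    exact this
  have hn : ∀ t z, ‖a t z‖ ≤ ‖z.1‖ + ‖z.2‖ := fun t z => by
    refine (norm_add_le _ _).trans (add_le_add ?_ ?_)
    · rw [norm_smul]
      exact mul_le_of_le_one_left (norm_nonneg _) (Real.abs_cos_le_one t)
    · rw [norm_smul]
      exact mul_le_of_le_one_left (norm_nonneg _) (Real.abs_sin_le_one t)
  have hn' : ∀ t z, ‖a' t z‖ ≤ ‖z.1‖ + ‖z.2‖ := fun t z => by
    refine (norm_add_le _ _).trans (add_le_add ?_ ?_)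
    · rw [norm_smul, norm_neg]
      exact mul_le_of_le_one_left (norm_nonneg _) (Real.abs_sin_le_one t)
    · rw [norm_smul]
      exact mul_le_of_le_one_left (norm_nonneg _) (Real.abs_cos_le_one t)
  obtain ⟨C, m, hC, hg⟩ := hh.growth
  obtain ⟨D, l, hD, hg'⟩ := hh.growth_fderiv
  let N : E × E → ℝ := fun z => ‖z.1‖ + ‖z.2‖
  have hNc : Continuous N := by fun_prop
  have hN0 : ∀ z, 0 ≤ N z := fun z => by positivity
  have hN : PolyBounded N :=
    (PolyBounded.clm (ContinuousLinearMap.fst ℝ E E)).norm.add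
      (PolyBounded.clm (ContinuousLinearMap.snd ℝ E E)).norm
  let b : E × E → ℝ := fun z =>
    D * (1 + N z) ^ l * N z * (‖L‖ * N z) + C * (1 + N z) ^ m * (‖L‖ * N z)
  have hb : PolyBounded b := by
    have h1 : PolyBounded fun z => 1 + N z := (PolyBounded.const 1).add hN
    exact ((((PolyBounded.const D).mul (h1.pow l)).mul hN).mul ((PolyBounded.const _).mul hN)).add
      (((PolyBounded.const C).mul (h1.pow m)).mul ((PolyBounded.const _).mul hN))
  let k : ℝ → E × E → ℝ := fun t z => h (a t z) * L (a' t z)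
  let k' : ℝ → E × E → ℝ := fun t z =>
    fderiv ℝ h (a t z) (a' t z) * L (a' t z) + h (a t z) * L (-a t z)
  have hkc : ∀ t, Continuous (k t) := fun t =>
    (hh.continuous.comp (hac t)).mul (L.continuous.comp (hac' t))
  have hkb : ∀ t, PolyBounded (k t) := fun t => by
    have h1 : TemperedC1 (a t) :=
      TemperedC1.clm (Real.cos t • ContinuousLinearMap.fst ℝ E E +
        Real.sin t • ContinuousLinearMap.snd ℝ E E)
    have h2 : TemperedC1 (a' t) :=
      TemperedC1.clm (-(Real.sin t) • ContinuousLinearMap.fst ℝ E E +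
        Real.cos t • ContinuousLinearMap.snd ℝ E E)
    exact ((hh.comp h1).mul ((TemperedC1.clm L).comp h2)).growth
  have hL : ∀ y z, ‖y‖ ≤ N z → ‖L y‖ ≤ ‖L‖ * N z := fun y z hy =>
    (L.le_opNorm y).trans (by gcongr)
  have key := hasDerivAt_integral_of_polyBounded (μ := μ.prod μ) (k := k) (k' := k') (b := b)
    (fun t => (hkb t).integrable' (hkc t))
    (fun t => ((hh.continuous_fderiv.comp (hac t)).clm_apply (hac' t)).mul
      (L.continuous.comp (hac' t)) |>.add ((hh.continuous.comp (hac t)).mul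
      (L.continuous.comp (hac t).neg)))
    hb (by fun_prop)
    (fun t z => by
      refine (norm_add_le _ _).trans (add_le_add ?_ ?_)
      · rw [norm_mul]
        have := hN0 z
        gcongr
        · refine (ContinuousLinearMap.le_opNorm _ _).trans ?_
          gcongr
          · refine (hg' _).trans ?_
            gcongr
            exact hn t z
          · exact hn' t z
        · exact hL _ _ (hn' t z)
      · rw [norm_mul]
        have := hN0 z
        gcongr
        · refine (hg _).trans ?_
          gcongr
          exact hn t z
        · exact hL _ _ (by simpa using hn t z))
    (fun t z => (((hh.differentiable (a t z)).hasFDerivAt.comp_hasDerivAt t (ha t z)).mul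
      (L.hasFDerivAt.comp_hasDerivAt t (ha' t z)))) 0
  have hconst : ∀ t, ∫ z, k t z ∂(μ.prod μ) = ∫ z, k 0 z ∂(μ.prod μ) := fun t => by
    conv_rhs => rw [← IsGaussian.map_rotation_eq_self (μ := μ) (by simpa using hμ) t]
    rw [integral_map (by fun_prop) (hkc 0).aestronglyMeasurable]
    refine integral_congr_ae (ae_of_all _ fun z => ?_)
    simp [k, a, a', ContinuousLinearMap.rotation_apply]
  have hzero : ∫ z, k' 0 z ∂(μ.prod μ) = 0 := by
    have h1 : HasDerivAt (fun t => ∫ z, k t z ∂(μ.prod μ)) 0 0 := by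
      simp_rw [hconst]
      exact hasDerivAt_const _ _
    exact key.unique h1
  have e1 : k' 0 = fun z : E × E => fderiv ℝ h z.1 z.2 * L z.2 - L z.1 * h z.1 := by
    ext z
    simp [k', a, a']
    ring
  have i1 : Integrable (fun z : E × E => fderiv ℝ h z.1 z.2 * L z.2) (μ.prod μ) := by
    refine PolyBounded.integrable' (((hh.growth_fderiv.comp
      (PolyBounded.clm (ContinuousLinearMap.fst ℝ E E))).clm_apply
      (PolyBounded.clm (ContinuousLinearMap.snd ℝ E E))).mul
      (PolyBounded.clm (L.comp (ContinuousLinearMap.snd ℝ E E)))) ?_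
    exact ((hh.continuous_fderiv.comp continuous_fst).clm_apply continuous_snd).mul
      (L.continuous.comp continuous_snd)
  have i0 : Integrable (fun x : E => L x * h x) μ :=
    ((PolyBounded.clm L).mul hh.growth).integrable' (L.continuous.mul hh.continuous)
  have i2 : Integrable (fun z : E × E => L z.1 * h z.1) (μ.prod μ) := i0.comp_fst μ
  have i3 : Integrable (fun z : E => L z • z) μ :=
    ((PolyBounded.clm L).smul PolyBounded.id).integrable' (L.continuous.smul continuous_id)
  rw [e1, integral_sub i1 i2, sub_eq_zero, integral_prod _ i1] at hzero
  have e2 : ∫ z : E × E, L z.1 * h z.1 ∂(μ.prod μ) = ∫ x, L x * h x ∂μ := by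
    rw [integral_fun_fst (fun x => L x * h x)]
    simp
  rw [← e2, ← hzero]
  refine integral_congr_ae (ae_of_all _ fun x => ?_)
  simp only
  rw [← (fderiv ℝ h x).integral_comp_comm i3]
  refine integral_congr_ae (ae_of_all _ fun y => ?_)
  simp [mul_comm]

end Growth

/-! ### Smoothing of Lipschitz functions. -/

section Mollify

open ContinuousLinearMap
open scoped Convolution

variable {M F G : Type*} [NormedAddCommGroup M] [InnerProductSpace ℝ M] [FiniteDimensional ℝ M]
  [MeasurableSpace M] [BorelSpace M] [NormedAddCommGroup F] [NormedSpace ℝ F]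
  [NormedAddCommGroup G] [NormedSpace ℝ G]

/-- The kernel is vector-valued so as to cover both the mollifier, where it preserves the constant
1, and its derivative, where it bounds the second derivative of the mollified function. -/
lemma lipschitzWith_convolution {k : M → F} {g : M → ℝ} (L : F →L[ℝ] ℝ →L[ℝ] G)
    (hk : Continuous k) (hks : HasCompactSupport k) (hg : LipschitzWith 1 g) :
    LipschitzWith (Real.toNNReal (‖L‖ * ∫ t, ‖k t‖)) (k ⋆[L, volume] g) := by
  refine LipschitzWith.of_dist_le_mul fun x y => ?_
  have hex := hks.convolutionExists_left (μ := volume) L hk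
    (hg.continuous.locallyIntegrable)
  have hi : Integrable (fun t => ‖k t‖) := (hk.integrable_of_hasCompactSupport hks).norm
  rw [Real.coe_toNNReal _ (by positivity), dist_eq_norm, dist_eq_norm, convolution_def,
    convolution_def, ← integral_sub (hex x) (hex y), mul_assoc, ← integral_mul_const,
    ← integral_const_mul]
  refine norm_integral_le_of_norm_le ((hi.mul_const _).const_mul _) (ae_of_all _ fun t => ?_)
  rw [← map_sub, ← mul_assoc]
  refine (L.le_opNorm₂ _ _).trans ?_
  gcongr
  have := hg.dist_le_mul (x - t) (y - t)
  simpa [dist_eq_norm] using this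

/-- A `1`-Lipschitz function on a Euclidean space is a uniform limit of smooth `1`-Lipschitz
functions with bounded second derivative. -/
theorem exists_contDiff_approx {g : M → ℝ} (hg : LipschitzWith 1 g) {δ : ℝ} (hδ : 0 < δ) :
    ∃ f : M → ℝ, ContDiff ℝ 2 f ∧ LipschitzWith 1 f ∧
      (∃ B, ∀ x, ‖fderiv ℝ (fderiv ℝ f) x‖ ≤ B) ∧ ∀ x, |f x - g x| ≤ δ := by
  let φ : ContDiffBump (0 : M) := ⟨δ / 2, δ, by positivity, by linarith⟩
  let k : M → ℝ := φ.normed volume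
  have hkc : ContDiff ℝ 2 k := φ.contDiff_normed
  have hks : HasCompactSupport k := φ.hasCompactSupport_normed
  have hgl : LocallyIntegrable g := hg.continuous.locallyIntegrable
  let f : M → ℝ := k ⋆[lsmul ℝ ℝ, volume] g
  -- One derivative falls on the kernel; the result is again a convolution with `g`, hence
  -- Lipschitz, which bounds the second derivative although `g` may be unbounded.
  have hf' : fderiv ℝ f = fderiv ℝ k ⋆[(lsmul ℝ ℝ).precompL M, volume] g :=
    funext fun x => (hks.hasFDerivAt_convolution_left (lsmul ℝ ℝ)
      (hkc.of_le one_le_two) hgl x).fderiv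
  have hl := lipschitzWith_convolution ((lsmul ℝ ℝ).precompL M)
    (hkc.continuous_fderiv two_ne_zero) (hks.fderiv ℝ) hg
  rw [← hf'] at hl
  refine ⟨f, ?_, ?_, ⟨_, fun x => norm_fderiv_le_of_lipschitz ℝ hl⟩, fun x => ?_⟩
  · exact hks.contDiff_convolution_left (n := 2) (lsmul ℝ ℝ) hkc hgl
  · refine (lipschitzWith_convolution (lsmul ℝ ℝ) hkc.continuous hks hg).weaken ?_
    have h1 : ∫ t, ‖k t‖ = 1 := by
      rw [← φ.integral_normed (μ := volume)]
      exact integral_congr_ae (ae_of_all _ fun t => Real.norm_of_nonneg (φ.nonneg_normed t))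
    rw [h1, mul_one, Real.toNNReal_le_one]
    exact opNorm_lsmul_le
  · rw [← Real.dist_eq]
    refine φ.dist_normed_convolution_le hg.continuous.aestronglyMeasurable fun y hy => ?_
    have := hg.dist_le_mul y x
    simp only [NNReal.coe_one, one_mul] at this
    exact this.trans (Metric.mem_ball.1 hy).le

end Mollify

/-! ### Integration by parts in one factor of a product measure. -/

section Products

variable {A B : Type*} [NormedAddCommGroup A] [NormedSpace ℝ A] [CompleteSpace A]
  [SecondCountableTopology A] [MeasurableSpace A] [BorelSpace A]
  [NormedAddCommGroup B] [NormedSpace ℝ B] [CompleteSpace B]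
  [SecondCountableTopology B] [MeasurableSpace B] [BorelSpace B]
  {μ : Measure A} {ν : Measure B} [IsGaussian μ] [IsGaussian ν]

lemma integral_prod_id (hμ : ∫ x, x ∂μ = 0) (hν : ∫ x, x ∂ν = 0) :
    ∫ z, z ∂(μ.prod ν) = 0 := by
  have h1 : Integrable (fun z : A × B => z.1) (μ.prod ν) := IsGaussian.integrable_id.fst
  have h2 : Integrable (fun z : A × B => z.2) (μ.prod ν) := IsGaussian.integrable_id.snd
  have := integral_pair h1 h2
  simp only [Prod.mk.eta] at this
  rw [this, integral_fun_fst (fun x => x), integral_fun_snd (fun x => x), hμ, hν]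
  simp

lemma integrable_dual_smul (L : A →L[ℝ] ℝ) : Integrable (fun x => L x • x) μ :=
  ((PolyBounded.clm L).smul PolyBounded.id).integrable' (L.continuous.smul continuous_id)

lemma integral_dual_fst_smul (hν : ∫ x, x ∂ν = 0) (L : A →L[ℝ] ℝ) :
    ∫ z, L z.1 • z ∂(μ.prod ν) = (∫ x, L x • x ∂μ, 0) := by
  have h := integrable_dual_smul (μ := μ.prod ν) (L.comp (ContinuousLinearMap.fst ℝ A B))
  have := integral_pair h.fst h.snd
  simp only [Prod.mk.eta] at this
  refine this.trans (Prod.ext ?_ ?_)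
  · exact (integral_fun_fst (fun x => L x • x)).trans (by simp)
  · exact (integral_prod_smul L (fun x => x)).trans (by simp [hν])

lemma integral_dual_snd_smul (hμ : ∫ x, x ∂μ = 0) (L : B →L[ℝ] ℝ) :
    ∫ z, L z.2 • z ∂(μ.prod ν) = (0, ∫ x, L x • x ∂ν) := by
  have h := integrable_dual_smul (μ := μ.prod ν) (L.comp (ContinuousLinearMap.snd ℝ A B))
  have := integral_pair h.fst h.snd
  simp only [Prod.mk.eta] at this
  refine this.trans (Prod.ext ?_ ?_)
  · refine (integral_prod_swap (μ := μ) (ν := ν) (fun z : A × B => L z.2 • z.1)).symm.trans ?_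
    exact (integral_prod_smul L (fun x => x)).trans (by simp [hμ])
  · exact (integral_fun_snd (fun x : B => L x • x)).trans (by simp)

/-- Independent centered factors are uncorrelated, so the direction of differentiation has no
component in the second factor. -/
lemma integral_dual_fst_mul_eq (hμ : ∫ x, x ∂μ = 0) (hν : ∫ x, x ∂ν = 0) (L : A →L[ℝ] ℝ)
    {h : A × B → ℝ} (hh : TemperedC1 h) :
    ∫ z, L z.1 * h z ∂(μ.prod ν) =
      ∫ z, fderiv ℝ h z (∫ x, L x • x ∂μ, 0) ∂(μ.prod ν) := by
  have := integral_dual_mul_eq (μ := μ.prod ν) (integral_prod_id hμ hν)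
    (L.comp (ContinuousLinearMap.fst ℝ A B)) hh
  simpa [integral_dual_fst_smul hν] using this

lemma integral_dual_snd_mul_eq (hμ : ∫ x, x ∂μ = 0) (hν : ∫ x, x ∂ν = 0) (L : B →L[ℝ] ℝ)
    {h : A × B → ℝ} (hh : TemperedC1 h) :
    ∫ z, L z.2 * h z ∂(μ.prod ν) =
      ∫ z, fderiv ℝ h z (0, ∫ x, L x • x ∂ν) ∂(μ.prod ν) := by
  have := integral_dual_mul_eq (μ := μ.prod ν) (integral_prod_id hμ hν)
    (L.comp (ContinuousLinearMap.snd ℝ A B)) hh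
  simpa [integral_dual_snd_smul hμ] using this

end Products

/-! ### Second moments of the standard Gaussian. -/

section StdGaussian

variable {ι M : Type*} [Fintype ι] [NormedAddCommGroup M] [InnerProductSpace ℝ M]
  [FiniteDimensional ℝ M] [MeasurableSpace M] [BorelSpace M]

lemma inner_integral_inner_smul {ν : Measure M} [IsGaussian ν] (u v : M) :
    inner ℝ v (∫ x, inner ℝ u x • x ∂ν) = ∫ x, inner ℝ u x * inner ℝ v x ∂ν := by
  have := (innerSL ℝ v).integral_comp_comm (integrable_dual_smul (μ := ν) (innerSL ℝ u))
  simpa [inner_smul_right] using this.symm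

lemma integral_inner_smul_stdGaussian (u : M) :
    ∫ x, inner ℝ u x • x ∂(stdGaussian M) = u := by
  refine ext_inner_left ℝ fun v => ?_
  have h := covarianceBilin_apply (μ := stdGaussian M) IsGaussian.memLp_two_id u v
  rw [covarianceBilin_stdGaussian, innerSL_apply_apply] at h
  rw [inner_integral_inner_smul, real_inner_comm, h]
  simp

lemma integral_norm_sq_stdGaussian (b : OrthonormalBasis ι ℝ M) :
    ∫ x, ‖x‖ ^ 2 ∂(stdGaussian M) = Fintype.card ι := by
  simp_rw [← b.sum_sq_inner_right]
  rw [integral_finsetSum]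
  · simp_rw [pow_two, ← inner_integral_inner_smul, integral_inner_smul_stdGaussian]
    simp
  · intro a _
    exact ((PolyBounded.clm (innerSL ℝ (b a))).pow 2).integrable' (by fun_prop)

end StdGaussian

/-! ### Integration by parts along the noisy interpolation. -/

section Interpolation

variable {V M ι : Type*} [NormedAddCommGroup V] [NormedSpace ℝ V] [NormedAddCommGroup M]
  [InnerProductSpace ℝ M] [Fintype ι]

/-- The interpolation `p • w(x) + q • y + ε • z`. -/
noncomputable def interp {V : Type*} (w : V → M) (p q ε : ℝ) (y : V × M × M) : M :=
  p • w y.1 + q • y.2.1 + ε • y.2.2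

lemma tempered_fst : TemperedC1 (fun y : V × M × M => y.1) :=
  TemperedC1.clm (ContinuousLinearMap.fst ℝ V (M × M))

lemma tempered_snd_fst : TemperedC1 (fun y : V × M × M => y.2.1) :=
  TemperedC1.clm ((ContinuousLinearMap.fst ℝ M M).comp (ContinuousLinearMap.snd ℝ V (M × M)))

lemma tempered_snd_snd : TemperedC1 (fun y : V × M × M => y.2.2) :=
  TemperedC1.clm ((ContinuousLinearMap.snd ℝ M M).comp (ContinuousLinearMap.snd ℝ V (M × M)))

lemma TemperedC1.inner_left {E : Type*} [NormedAddCommGroup E] [NormedSpace ℝ E] {f : E → M}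
    (hf : TemperedC1 f) (v : M) : TemperedC1 (fun x => inner ℝ v (f x)) :=
  hf.clm_comp (innerSL ℝ v)

lemma tempered_interp {w : V → M} (hw : TemperedC1 w) (p q ε : ℝ) :
    TemperedC1 (interp w p q ε) :=
  (((hw.comp tempered_fst).const_smul p).add (tempered_snd_fst.const_smul q)).add
    (tempered_snd_snd.const_smul ε)

lemma fderiv_comp_interp {w : V → M} (hw : TemperedC1 w) (p q ε : ℝ) {F : M → ℝ}
    (hF : Differentiable ℝ F) (y v : V × M × M) :
    fderiv ℝ (fun y => F (interp w p q ε y)) y v =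
      fderiv ℝ F (interp w p q ε y) (p • fderiv ℝ w y.1 v.1 + q • v.2.1 + ε • v.2.2) := by
  have h1 : HasFDerivAt (fun y : V × M × M => w y.1)
      ((fderiv ℝ w y.1).comp (ContinuousLinearMap.fst ℝ V (M × M))) y :=
    (hw.differentiable y.1).hasFDerivAt.comp y hasFDerivAt_fst
  have h2 : HasFDerivAt (interp w p q ε)
      (p • (fderiv ℝ w y.1).comp (ContinuousLinearMap.fst ℝ V (M × M)) +
        q • (ContinuousLinearMap.fst ℝ M M).comp (ContinuousLinearMap.snd ℝ V (M × M)) +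
        ε • (ContinuousLinearMap.snd ℝ M M).comp (ContinuousLinearMap.snd ℝ V (M × M))) y :=
    ((h1.const_smul p).add (hasFDerivAt_snd.fst.const_smul q)).add
      (hasFDerivAt_snd.snd.const_smul ε)
  have h3 : HasFDerivAt (fun y => F (interp w p q ε y)) _ y := (hF _).hasFDerivAt.comp y h2
  rw [h3.fderiv]
  simp

variable [MeasurableSpace V] [FiniteDimensional ℝ M] [MeasurableSpace M]

/-- The joint law of independent vectors with laws `μ`, `ν` and a standard Gaussian vector. -/
noncomputable abbrev jointLaw (μ : Measure V) (ν : Measure M) : Measure (V × M × M) :=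
  μ.prod (ν.prod (stdGaussian M))

variable {μ : Measure V} {ν : Measure M}

/-- The field `ξ` moves only the argument of `w`, so the chain rule leaves the factor `p` and the
vector $Dw(\xi)=T$. -/
lemma integral_stein_kernel_interp {w : V → M} (hw : TemperedC1 w) (p q ε : ℝ)
    {e : M} {ξ : V → V} {T : V → M}
    (hξ : ∀ h : V × M × M → ℝ, TemperedC1 h →
      ∫ y, inner ℝ e (w y.1) * h y ∂(jointLaw μ ν) =
        ∫ y, fderiv ℝ h y (ξ y.1, 0) ∂(jointLaw μ ν))
    (hT : ∀ x, fderiv ℝ w x (ξ x) = T x) {F : M → ℝ} (hF : TemperedC1 F) :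
    ∫ y, inner ℝ e (w y.1) * F (interp w p q ε y) ∂(jointLaw μ ν) =
      p * ∫ y, fderiv ℝ F (interp w p q ε y) (T y.1) ∂(jointLaw μ ν) := by
  rw [hξ _ (hF.comp (tempered_interp hw p q ε)), ← integral_const_mul]
  refine integral_congr_ae (ae_of_all _ fun y => ?_)
  simp [fderiv_comp_interp hw p q ε hF.differentiable, hT]

variable [CompleteSpace V] [SecondCountableTopology V] [BorelSpace V] [BorelSpace M]
  [IsGaussian μ] [IsGaussian ν]

lemma integral_gaussian_interp (hμ : ∫ x, x ∂μ = 0) (hν : ∫ x, x ∂ν = 0) {w : V → M}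
    (hw : TemperedC1 w) (p q ε : ℝ) (e : M) {F : M → ℝ} (hF : TemperedC1 F) :
    ∫ y, inner ℝ e y.2.1 * F (interp w p q ε y) ∂(jointLaw μ ν) =
      q * ∫ y, fderiv ℝ F (interp w p q ε y) (∫ x, inner ℝ e x • x ∂ν) ∂(jointLaw μ ν) := by
  have h0 : ∫ x, x ∂(stdGaussian M) = 0 := integral_id_stdGaussian
  have := integral_dual_snd_mul_eq (μ := μ) (ν := ν.prod (stdGaussian M)) hμ
    (integral_prod_id hν h0) ((innerSL ℝ e).comp (ContinuousLinearMap.fst ℝ M M))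
    (hF.comp (tempered_interp hw p q ε))
  have h2 := integral_dual_fst_smul (μ := ν) h0 (innerSL ℝ e)
  simp only [ContinuousLinearMap.comp_apply, ContinuousLinearMap.coe_fst', innerSL_apply_apply]
    at this h2
  rw [this, h2, ← integral_const_mul]
  refine integral_congr_ae (ae_of_all _ fun y => ?_)
  simp [fderiv_comp_interp hw p q ε hF.differentiable]

/-- Read from right to left, this removes a derivative from `F` at the price of $1/\varepsilon$. The
vector `Q` depends only on the first variable, so differentiating in the noise direction leaves it
untouched. -/
lemma integral_noise_interp (hμ : ∫ x, x ∂μ = 0) (hν : ∫ x, x ∂ν = 0) {w : V → M}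
    (hw : TemperedC1 w) (p q ε : ℝ) {Q : V → M} (hQ : TemperedC1 Q) {F : M → ℝ}
    (hF : TemperedC1 F) :
    ∫ y, inner ℝ (Q y.1) y.2.2 * F (interp w p q ε y) ∂(jointLaw μ ν) =
      ε * ∫ y, fderiv ℝ F (interp w p q ε y) (Q y.1) ∂(jointLaw μ ν) := by
  let B := stdOrthonormalBasis ℝ M
  have h0 : ∫ x, x ∂(stdGaussian M) = 0 := integral_id_stdGaussian
  have hFU := hF.comp (tempered_interp hw p q ε)
  have hQb : ∀ b, TemperedC1 (fun y : V × M × M => inner ℝ (B b) (Q y.1)) := fun b =>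
    (hQ.comp tempered_fst).inner_left (B b)
  have key : ∀ b, ∫ y, inner ℝ (B b) y.2.2 *
        (inner ℝ (B b) (Q y.1) * F (interp w p q ε y)) ∂(jointLaw μ ν) =
      ε * ∫ y, inner ℝ (B b) (Q y.1) * fderiv ℝ F (interp w p q ε y) (B b) ∂(jointLaw μ ν) := by
    intro b
    have hh := (hQb b).mul hFU
    have := integral_dual_snd_mul_eq (μ := μ) (ν := ν.prod (stdGaussian M)) hμ
      (integral_prod_id hν h0) ((innerSL ℝ (B b)).comp (ContinuousLinearMap.snd ℝ M M)) hh
    have h2 := integral_dual_snd_smul (μ := ν) (ν := stdGaussian M) hν (innerSL ℝ (B b))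
    simp only [ContinuousLinearMap.comp_apply, ContinuousLinearMap.coe_snd', innerSL_apply_apply]
      at this h2
    rw [this, h2, ← integral_const_mul, integral_inner_smul_stdGaussian]
    refine integral_congr_ae (ae_of_all _ fun y => ?_)
    have h3 : HasFDerivAt (fun y : V × M × M => inner ℝ (B b) (Q y.1))
        ((innerSL ℝ (B b)).comp
          ((fderiv ℝ Q y.1).comp (ContinuousLinearMap.fst ℝ V (M × M)))) y :=
      (innerSL ℝ (B b)).hasFDerivAt.comp y
        ((hQ.differentiable y.1).hasFDerivAt.comp y hasFDerivAt_fst)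
    simp only
    rw [fderiv_fun_mul h3.differentiableAt (hFU.differentiable y), h3.fderiv]
    simp [fderiv_comp_interp hw p q ε hF.differentiable]
    ring
  have e1 : ∀ y : V × M × M, inner ℝ (Q y.1) y.2.2 * F (interp w p q ε y) =
      ∑ b, inner ℝ (B b) y.2.2 * (inner ℝ (B b) (Q y.1) * F (interp w p q ε y)) := fun y => by
    rw [← B.sum_inner_mul_inner, Finset.sum_mul]
    refine Finset.sum_congr rfl fun b _ => ?_
    rw [real_inner_comm (B b) (Q y.1)]
    ring
  have e2 : ∀ y : V × M × M, fderiv ℝ F (interp w p q ε y) (Q y.1) =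
      ∑ b, inner ℝ (B b) (Q y.1) * fderiv ℝ F (interp w p q ε y) (B b) := fun y => by
    conv_lhs => rw [← B.sum_repr' (Q y.1)]
    simp [map_sum]
  simp_rw [e1, e2]
  have i1 : ∀ b, Integrable (fun y => inner ℝ (B b) y.2.2 *
      (inner ℝ (B b) (Q y.1) * F (interp w p q ε y))) (jointLaw μ ν) := fun b =>
    have := (tempered_snd_snd.inner_left (B b)).mul ((hQb b).mul hFU)
    this.growth.integrable' this.continuous
  have i2 : ∀ b, Integrable (fun y => inner ℝ (B b) (Q y.1) *
      fderiv ℝ F (interp w p q ε y) (B b)) (jointLaw μ ν) := fun b => by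
    have hU := tempered_interp hw p q ε
    exact ((hQb b).growth.mul ((hF.growth_fderiv.comp hU.growth).clm_apply
      (.const _))).integrable' ((hQb b).continuous.mul
      ((hF.continuous_fderiv.comp hU.continuous).clm_apply continuous_const))
  rw [integral_finsetSum _ fun b _ => i1 b, integral_finsetSum _ fun b _ => i2 b, Finset.mul_sum]
  exact Finset.sum_congr rfl fun b _ => key b

end Interpolation

/-! ### Wasserstein bound from a Stein kernel. -/

section SteinBound

variable {V M ι : Type*} [NormedAddCommGroup V] [NormedSpace ℝ V] [NormedAddCommGroup M]
  [InnerProductSpace ℝ M] [Fintype ι]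

lemma TemperedC1.of_lipschitz {g : M → ℝ} (hg : ContDiff ℝ 2 g) (hl : LipschitzWith 1 g) :
    TemperedC1 g := by
  refine ⟨hg.of_le one_le_two, ?_, .of_bounded 1 fun x => norm_fderiv_le_of_lipschitz ℝ hl⟩
  refine ((PolyBounded.const |g 0|).add PolyBounded.id.norm).of_le fun x => ?_
  have h1 := hl.dist_le_mul x 0
  rw [Real.dist_eq, NNReal.coe_one, one_mul, dist_zero_right] at h1
  have h2 : |g x| ≤ |g 0| + |g x - g 0| := by
    simpa using abs_add_le (g 0) (g x - g 0)
  simp only [Real.norm_eq_abs]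
  exact (h2.trans (by linarith)).trans (le_abs_self _)

lemma TemperedC1.fderiv_of_bounded {g : M → ℝ} (hg : ContDiff ℝ 2 g) (hl : LipschitzWith 1 g)
    {K : ℝ} (hK : ∀ x, ‖fderiv ℝ (fderiv ℝ g) x‖ ≤ K) : TemperedC1 (fderiv ℝ g) :=
  ⟨hg.fderiv_right (by norm_num), .of_bounded 1 fun x => norm_fderiv_le_of_lipschitz ℝ hl,
    .of_bounded K hK⟩

lemma hasDerivAt_interp {V : Type*} (w : V → M) (ε t : ℝ) (y : V × M × M) :
    HasDerivAt (fun t => interp w (Real.sin t) (Real.cos t) ε y)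
      (Real.cos t • w y.1 - Real.sin t • y.2.1) t := by
  have h := (((Real.hasDerivAt_sin t).smul_const (w y.1)).add
    ((Real.hasDerivAt_cos t).smul_const y.2.1)).add (hasDerivAt_const t (ε • y.2.2))
  rw [add_zero, neg_smul, ← sub_eq_add_neg] at h
  exact h

/-- The Hilbert–Schmidt norm dominates the operator norm. The weight `κ` replaces Cauchy–Schwarz
under the integral, so that only second moments have to be integrated. -/
lemma norm_sum_inner_smul_le (b : OrthonormalBasis ι ℝ M) (Q : ι → M) (z : M) {κ : ℝ}
    (hκ : 0 < κ) :
    ‖∑ a, inner ℝ (Q a) z • b a‖ ≤ (κ * ∑ a, ‖Q a‖ ^ 2 + κ⁻¹ * ‖z‖ ^ 2) / 2 := by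
  have h1 : ‖∑ a, inner ℝ (Q a) z • b a‖ ^ 2 = ∑ a, inner ℝ (Q a) z ^ 2 := by
    rw [← real_inner_self_eq_norm_sq, b.orthonormal.inner_sum]
    simp [pow_two]
  have h2 : ∑ a, inner ℝ (Q a) z ^ 2 ≤ (∑ a, ‖Q a‖ ^ 2) * ‖z‖ ^ 2 := by
    rw [Finset.sum_mul]
    refine Finset.sum_le_sum fun a _ => ?_
    rw [← mul_pow, ← sq_abs]
    exact pow_le_pow_left₀ (abs_nonneg _) (abs_real_inner_le_norm _ _) 2
  have h3 : 0 ≤ ∑ a, ‖Q a‖ ^ 2 := by positivity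
  refine le_of_sq_le_sq ?_ (by positivity)
  have h4 : (κ * ∑ a, ‖Q a‖ ^ 2) * (κ⁻¹ * ‖z‖ ^ 2) = (∑ a, ‖Q a‖ ^ 2) * ‖z‖ ^ 2 := by
    field_simp
  nlinarith [sq_nonneg (κ * ∑ a, ‖Q a‖ ^ 2 - κ⁻¹ * ‖z‖ ^ 2)]

variable [SecondCountableTopology V] [MeasurableSpace V]
  [FiniteDimensional ℝ M] [MeasurableSpace M] [BorelSpace M]
  {μ : Measure V} {ν : Measure M} [IsGaussian μ] [IsGaussian ν]

lemma integral_snd_snd_norm_sq (b : OrthonormalBasis ι ℝ M) :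
    ∫ y, ‖y.2.2‖ ^ 2 ∂(jointLaw μ ν) = Fintype.card ι := by
  rw [← integral_norm_sq_stdGaussian b]
  refine (integral_fun_snd (μ := μ) (ν := ν.prod (stdGaussian M))
    (fun z : M × M => ‖z.2‖ ^ 2)).trans ?_
  rw [integral_fun_snd (μ := ν) (ν := stdGaussian M) (fun z : M => ‖z‖ ^ 2)]
  simp

variable [CompleteSpace V] [BorelSpace V]

lemma hasDerivAt_integral_interp {w : V → M} (hw : TemperedC1 w) (ε : ℝ) {g : M → ℝ}
    (hg : ContDiff ℝ 2 g) (hl : LipschitzWith 1 g) (t : ℝ) :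
    HasDerivAt (fun t => ∫ y, g (interp w (Real.sin t) (Real.cos t) ε y) ∂(jointLaw μ ν))
      (∫ y, fderiv ℝ g (interp w (Real.sin t) (Real.cos t) ε y)
        (Real.cos t • w y.1 - Real.sin t • y.2.1) ∂(jointLaw μ ν)) t := by
  have hw1 : TemperedC1 (fun y : V × M × M => w y.1) := hw.comp tempered_fst
  have hgT := TemperedC1.of_lipschitz hg hl
  refine hasDerivAt_integral_of_polyBounded (μ := jointLaw μ ν)
    (k := fun t y => g (interp w (Real.sin t) (Real.cos t) ε y))
    (k' := fun t y => fderiv ℝ g (interp w (Real.sin t) (Real.cos t) ε y)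
        (Real.cos t • w y.1 - Real.sin t • y.2.1))
    (b := fun y : V × M × M => ‖w y.1‖ + ‖y.2.1‖) (fun t => ?_) (fun t => ?_)
    (hw1.growth.norm.add tempered_snd_fst.growth.norm)
    (hw1.continuous.norm.add tempered_snd_fst.continuous.norm) (fun t y => ?_)
    (fun t y => ?_) t
  · have := hgT.comp (tempered_interp hw (Real.sin t) (Real.cos t) ε)
    exact this.growth.integrable' this.continuous
  · exact (hgT.continuous_fderiv.comp (tempered_interp hw _ _ ε).continuous).clm_apply
      ((hw1.continuous.const_smul _).sub (tempered_snd_fst.continuous.const_smul _))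
  · have h1 : ‖fderiv ℝ g (interp w (Real.sin t) (Real.cos t) ε y)‖ ≤ 1 :=
      norm_fderiv_le_of_lipschitz ℝ hl
    refine (ContinuousLinearMap.le_of_opNorm_le _ h1 _).trans ?_
    rw [one_mul]
    refine (norm_sub_le _ _).trans (add_le_add ?_ ?_)
    · rw [norm_smul]
      exact mul_le_of_le_one_left (norm_nonneg _) (Real.abs_cos_le_one t)
    · rw [norm_smul]
      exact mul_le_of_le_one_left (norm_nonneg _) (Real.abs_sin_le_one t)
  · exact (hgT.differentiable _).hasFDerivAt.comp_hasDerivAt t (hasDerivAt_interp w ε t y)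

/-- In each basis direction the Stein kernel contributes $pT_a$ and the Gaussian limit $qc_a$, so
$q\cdot pT_a-p\cdot qc_a=pq(T_a-c_a)$ is paired with $D^2g$. The factor `ε` is what the noise
identity needs to return to the first derivative of `g`, so the bound `K` on $D^2g$ does not appear
in the conclusion. -/
lemma integral_fderiv_interp (hμ : ∫ x, x ∂μ = 0) (hν : ∫ x, x ∂ν = 0)
    (b : OrthonormalBasis ι ℝ M) {w : V → M} (hw : TemperedC1 w) {ξ : ι → V → V} {T : ι → V → M}
    (hξ : ∀ a, ∀ h : V × M × M → ℝ, TemperedC1 h →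
      ∫ y, inner ℝ (b a) (w y.1) * h y ∂(jointLaw μ ν) =
        ∫ y, fderiv ℝ h y (ξ a y.1, 0) ∂(jointLaw μ ν))
    (hTd : ∀ a x, fderiv ℝ w x (ξ a x) = T a x) (hT : ∀ a, TemperedC1 (T a)) {g : M → ℝ}
    (hg : ContDiff ℝ 2 g) (hl : LipschitzWith 1 g) {K : ℝ}
    (hK : ∀ x, ‖fderiv ℝ (fderiv ℝ g) x‖ ≤ K) (ε t : ℝ) :
    ε * ∫ y, fderiv ℝ g (interp w (Real.sin t) (Real.cos t) ε y)
        (Real.cos t • w y.1 - Real.sin t • y.2.1) ∂(jointLaw μ ν) =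
      Real.sin t * Real.cos t * ∫ y, fderiv ℝ g (interp w (Real.sin t) (Real.cos t) ε y)
        (∑ a, inner ℝ (T a y.1 - ∫ x, inner ℝ (b a) x • x ∂ν) y.2.2 • b a) ∂(jointLaw μ ν) := by
  set p := Real.sin t
  set q := Real.cos t
  let c : ι → M := fun a => ∫ x, inner ℝ (b a) x • x ∂ν
  let F : ι → M → ℝ := fun a x => fderiv ℝ g x (b a)
  have hU := tempered_interp hw p q ε
  have hF : ∀ a, TemperedC1 (F a) := fun a =>
    (TemperedC1.fderiv_of_bounded hg hl hK).clm_comp (ContinuousLinearMap.apply ℝ ℝ (b a))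
  have hFU : ∀ a, TemperedC1 (fun y => F a (interp w p q ε y)) := fun a => (hF a).comp hU
  have hQ : ∀ a, TemperedC1 (fun x => T a x - c a) := fun a => (hT a).sub (.const _)
  have hQ1 : ∀ a, TemperedC1 (fun y : V × M × M => T a y.1 - c a) := fun a =>
    (hQ a).comp tempered_fst
  have hw1 : TemperedC1 (fun y : V × M × M => w y.1) := hw.comp tempered_fst
  have j1 : ∀ a, Integrable (fun y => inner ℝ (b a) (w y.1) * F a (interp w p q ε y))
      (jointLaw μ ν) := fun a =>
    have := (hw1.inner_left (b a)).mul (hFU a)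
    this.growth.integrable' this.continuous
  have j2 : ∀ a, Integrable (fun y => inner ℝ (b a) y.2.1 * F a (interp w p q ε y))
      (jointLaw μ ν) := fun a =>
    have := (tempered_snd_fst.inner_left (b a)).mul (hFU a)
    this.growth.integrable' this.continuous
  have j3 : ∀ a {R : V × M × M → M}, TemperedC1 R →
      Integrable (fun y => fderiv ℝ (F a) (interp w p q ε y) (R y)) (jointLaw μ ν) :=
    fun a R hR => (((hF a).growth_fderiv.comp hU.growth).clm_apply hR.growth).integrable'
      (((hF a).continuous_fderiv.comp hU.continuous).clm_apply hR.continuous)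
  have j4 : ∀ a, Integrable (fun y => inner ℝ (T a y.1 - c a) y.2.2 * F a (interp w p q ε y))
      (jointLaw μ ν) := fun a => by
    refine PolyBounded.integrable' (PolyBounded.mul ?_ (hFU a).growth)
      (((hQ1 a).continuous.inner tempered_snd_snd.continuous).mul (hFU a).continuous)
    exact .of_le_mul 1 zero_le_one (hQ1 a).growth
      (tempered_snd_snd (V := V) (M := M)).growth fun y => by
      rw [one_mul]
      exact abs_real_inner_le_norm _ _
  have j5 : ∀ a, Integrable (fun y => q * (inner ℝ (b a) (w y.1) * F a (interp w p q ε y)) -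
      p * (inner ℝ (b a) y.2.1 * F a (interp w p q ε y))) (jointLaw μ ν) := fun a =>
    ((j1 a).const_mul q).sub ((j2 a).const_mul p)
  have e1 : ∀ y : V × M × M, fderiv ℝ g (interp w p q ε y) (q • w y.1 - p • y.2.1) =
      ∑ a, (q * (inner ℝ (b a) (w y.1) * F a (interp w p q ε y)) -
        p * (inner ℝ (b a) y.2.1 * F a (interp w p q ε y))) := fun y => by
    conv_lhs => rw [← b.sum_repr' (w y.1), ← b.sum_repr' y.2.1]
    simp only [map_sub, map_smul, map_sum, smul_eq_mul, Finset.sum_sub_distrib, Finset.mul_sum, F]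
  have e2 : ∀ y : V × M × M, fderiv ℝ g (interp w p q ε y)
        (∑ a, inner ℝ (T a y.1 - c a) y.2.2 • b a) =
      ∑ a, inner ℝ (T a y.1 - c a) y.2.2 * F a (interp w p q ε y) := fun y => by
    simp [map_sum, F]
  change ε * ∫ y, fderiv ℝ g (interp w p q ε y) (q • w y.1 - p • y.2.1) ∂(jointLaw μ ν) =
    p * q * ∫ y, fderiv ℝ g (interp w p q ε y)
      (∑ a, inner ℝ (T a y.1 - c a) y.2.2 • b a) ∂(jointLaw μ ν)
  simp_rw [e1, e2]
  rw [integral_finsetSum _ fun a _ => j5 a, integral_finsetSum _ fun a _ => j4 a,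
    Finset.mul_sum, Finset.mul_sum]
  refine Finset.sum_congr rfl fun a _ => ?_
  rw [integral_sub ((j1 a).const_mul q) ((j2 a).const_mul p), integral_const_mul,
    integral_const_mul, integral_stein_kernel_interp hw p q ε (hξ a) (hTd a) (hF a),
    integral_gaussian_interp hμ hν hw p q ε (b a) (hF a),
    integral_noise_interp hμ hν hw p q ε (hQ a) (hF a)]
  simp only [map_sub]
  rw [integral_sub (j3 a ((hT a).comp tempered_fst)) (j3 a (.const (c a)))]
  ring

lemma integrable_snd_snd_norm_sq :
    Integrable (fun y : V × M × M => ‖y.2.2‖ ^ 2) (jointLaw μ ν) :=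
  ((tempered_snd_snd (V := V) (M := M)).growth.norm.pow 2).integrable' (by fun_prop)

lemma integral_snd_snd_norm_le [Nonempty ι] (b : OrthonormalBasis ι ℝ M) :
    ∫ y, ‖y.2.2‖ ∂(jointLaw μ ν) ≤ √(Fintype.card ι) := by
  have hm : 0 < √(Fintype.card ι : ℝ) := Real.sqrt_pos.2 (by exact_mod_cast Fintype.card_pos)
  set m := √(Fintype.card ι : ℝ) with hm_def
  have h1 : ∀ y : V × M × M, ‖y.2.2‖ ≤ (m⁻¹ * ‖y.2.2‖ ^ 2 + m) / 2 := fun y => by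
    have : m⁻¹ * ‖y.2.2‖ ^ 2 + m - 2 * ‖y.2.2‖ = m⁻¹ * (‖y.2.2‖ - m) ^ 2 := by
      field_simp
      ring
    have h2 : 0 ≤ m⁻¹ * (‖y.2.2‖ - m) ^ 2 := by positivity
    linarith
  have hi := integrable_snd_snd_norm_sq (μ := μ) (ν := ν)
  have hi' : Integrable (fun y : V × M × M => ‖y.2.2‖) (jointLaw μ ν) :=
    (tempered_snd_snd (V := V) (M := M)).growth.norm.integrable' (by fun_prop)
  refine (integral_mono hi'
    (((hi.const_mul m⁻¹).add (integrable_const m)).div_const 2) h1).trans ?_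
  simp only [Pi.add_apply]
  rw [integral_div, integral_add (hi.const_mul _) (integrable_const m), integral_const_mul,
    integral_snd_snd_norm_sq b]
  have : (Fintype.card ι : ℝ) = m * m := (Real.mul_self_sqrt (by positivity)).symm
  rw [this]
  simp
  field_simp
  norm_num

/-- The cost of the auxiliary noise, paid once at each end of the interpolation. -/
lemma abs_integral_add_smul_sub_le [Nonempty ι] (b : OrthonormalBasis ι ℝ M) {g : M → ℝ}
    (hg : ContDiff ℝ 2 g) (hl : LipschitzWith 1 g) {Z : V × M × M → M} (hZ : TemperedC1 Z)
    {ε : ℝ} (hε : 0 ≤ ε) :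
    |∫ y, g (Z y + ε • y.2.2) ∂(jointLaw μ ν) - ∫ y, g (Z y) ∂(jointLaw μ ν)| ≤
      ε * √(Fintype.card ι) := by
  have hgT := TemperedC1.of_lipschitz hg hl
  have h1 := hgT.comp (hZ.add (tempered_snd_snd.const_smul ε))
  have h2 := hgT.comp hZ
  rw [← integral_sub (h1.growth.integrable' h1.continuous) (h2.growth.integrable' h2.continuous)]
  have hi : Integrable (fun y : V × M × M => ‖y.2.2‖) (jointLaw μ ν) :=
    (tempered_snd_snd (V := V) (M := M)).growth.norm.integrable' (by fun_prop)
  rw [← Real.norm_eq_abs]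
  refine (norm_integral_le_of_norm_le (hi.const_mul ε) (ae_of_all _ fun y => ?_)).trans ?_
  · have := hl.dist_le_mul (Z y + ε • y.2.2) (Z y)
    simpa [dist_eq_norm, norm_smul, abs_of_nonneg hε] using this
  · rw [integral_const_mul]
    gcongr
    exact integral_snd_snd_norm_le b

/-- The noise level is taken to be `B` itself. The derivative along the path is then at most
$mB^2/B=mB$ and each end costs $mB$, where $m$ is the square root of the dimension. -/
lemma abs_integral_sub_integral_le_of_contDiff [Nonempty ι] (hμ : ∫ x, x ∂μ = 0)
    (hν : ∫ x, x ∂ν = 0)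
    (b : OrthonormalBasis ι ℝ M) {w : V → M} (hw : TemperedC1 w) {ξ : ι → V → V} {T : ι → V → M}
    (hξ : ∀ a, ∀ h : V × M × M → ℝ, TemperedC1 h →
      ∫ y, inner ℝ (b a) (w y.1) * h y ∂(jointLaw μ ν) =
        ∫ y, fderiv ℝ h y (ξ a y.1, 0) ∂(jointLaw μ ν))
    (hTd : ∀ a x, fderiv ℝ w x (ξ a x) = T a x) (hT : ∀ a, TemperedC1 (T a)) {B : ℝ} (hB : 0 < B)
    (hTB : ∑ a, ∫ x, ‖T a x - ∫ z, inner ℝ (b a) z • z ∂ν‖ ^ 2 ∂μ ≤ B ^ 4) {g : M → ℝ}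
    (hg : ContDiff ℝ 2 g) (hl : LipschitzWith 1 g) {K : ℝ}
    (hK : ∀ x, ‖fderiv ℝ (fderiv ℝ g) x‖ ≤ K) :
    |∫ x, g (w x) ∂μ - ∫ z, g z ∂ν| ≤ 4 * √(Fintype.card ι) * B := by
  have hm : 0 < √(Fintype.card ι : ℝ) := Real.sqrt_pos.2 (by exact_mod_cast Fintype.card_pos)
  have hmm : (Fintype.card ι : ℝ) = √(Fintype.card ι) * √(Fintype.card ι) :=
    (Real.mul_self_sqrt (by positivity)).symm
  set m := √(Fintype.card ι : ℝ) with hm_def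
  let c : ι → M := fun a => ∫ x, inner ℝ (b a) x • x ∂ν
  let φ : ℝ → ℝ := fun t => ∫ y, g (interp w (Real.sin t) (Real.cos t) B y) ∂(jointLaw μ ν)
  -- This weight equalizes $\kappa B^4$ and $\kappa^{-1}m^2$, both being $mB^2$.
  let κ : ℝ := m / B ^ 2
  have hκ : 0 < κ := by positivity
  have hQ : ∀ a, TemperedC1 (fun x => T a x - c a) := fun a => (hT a).sub (.const _)
  have hQi : ∀ a, Integrable (fun x => ‖T a x - c a‖ ^ 2) μ := fun a =>
    ((hQ a).growth.norm.pow 2).integrable' ((hQ a).continuous.norm.pow 2)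
  have hQi1 : ∀ a, Integrable (fun y : V × M × M => ‖T a y.1 - c a‖ ^ 2) (jointLaw μ ν) :=
    fun a => (hQi a).comp_fst _
  have hNi := integrable_snd_snd_norm_sq (μ := μ) (ν := ν)
  have hbound : ∀ t, |∫ y, fderiv ℝ g (interp w (Real.sin t) (Real.cos t) B y)
      (Real.cos t • w y.1 - Real.sin t • y.2.1) ∂(jointLaw μ ν)| ≤ m * B := fun t => by
    have h1 := integral_fderiv_interp hμ hν b hw hξ hTd hT hg hl hK B t
    have h2 : |∫ y, fderiv ℝ g (interp w (Real.sin t) (Real.cos t) B y)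
        (∑ a, inner ℝ (T a y.1 - c a) y.2.2 • b a) ∂(jointLaw μ ν)| ≤ m * B ^ 2 := by
      have hi : Integrable (fun y : V × M × M =>
          (κ * ∑ a, ‖T a y.1 - c a‖ ^ 2 + κ⁻¹ * ‖y.2.2‖ ^ 2) / 2) (jointLaw μ ν) :=
        (((integrable_finsetSum _ fun a _ => hQi1 a).const_mul κ).add
          (hNi.const_mul κ⁻¹)).div_const 2
      rw [← Real.norm_eq_abs]
      refine (norm_integral_le_of_norm_le hi (ae_of_all _ fun y => ?_)).trans ?_
      · have h3 : ‖fderiv ℝ g (interp w (Real.sin t) (Real.cos t) B y)‖ ≤ 1 :=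
          norm_fderiv_le_of_lipschitz ℝ hl
        refine (ContinuousLinearMap.le_of_opNorm_le _ h3 _).trans ?_
        rw [one_mul]
        exact norm_sum_inner_smul_le b _ _ hκ
      · rw [integral_div, integral_add ((integrable_finsetSum _ fun a _ => hQi1 a).const_mul κ)
          (hNi.const_mul κ⁻¹), integral_const_mul, integral_const_mul,
          integral_finsetSum _ fun a _ => hQi1 a, integral_snd_snd_norm_sq b]
        have h4 : ∑ a, ∫ y, ‖T a y.1 - c a‖ ^ 2 ∂(jointLaw μ ν) ≤ B ^ 4 := by
          refine le_of_eq_of_le (Finset.sum_congr rfl fun a _ => ?_) hTB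
          exact (integral_fun_fst (fun x => ‖T a x - c a‖ ^ 2)).trans (by simp [c])
        have h5 : κ * B ^ 4 + κ⁻¹ * Fintype.card ι = 2 * (m * B ^ 2) := by
          rw [hmm]
          simp only [κ]
          field_simp
          ring
        nlinarith [mul_le_mul_of_nonneg_left h4 hκ.le]
    have h6 : |Real.sin t * Real.cos t| ≤ 1 := by
      rw [abs_mul]
      exact mul_le_one₀ (Real.abs_sin_le_one t) (abs_nonneg _) (Real.abs_cos_le_one t)
    have h7 := congrArg abs h1
    rw [abs_mul, abs_mul, abs_of_pos hB] at h7
    have h8 := mul_le_mul h6 h2 (abs_nonneg _) zero_le_one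
    refine le_of_mul_le_mul_left ?_ hB
    calc _ = _ := h7
      _ ≤ 1 * (m * B ^ 2) := h8
      _ = _ := by ring
  have hd := hasDerivAt_integral_interp (μ := μ) (ν := ν) hw B hg hl
  have hmv : |φ (Real.pi / 2) - φ 0| ≤ m * B * (Real.pi / 2) := by
    have := Convex.norm_image_sub_le_of_norm_hasDerivWithin_le (s := Set.univ) (f := φ)
      (fun t _ => (hd t).hasDerivWithinAt) (fun t _ => hbound t) convex_univ
      (Set.mem_univ 0) (Set.mem_univ (Real.pi / 2))
    rwa [sub_zero, Real.norm_eq_abs, Real.norm_eq_abs, abs_of_pos Real.pi_div_two_pos] at this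
  have hend : |φ (Real.pi / 2) - ∫ x, g (w x) ∂μ| ≤ B * m := by
    have := abs_integral_add_smul_sub_le (μ := μ) (ν := ν) b hg hl (hw.comp tempered_fst) hB.le
    have e : ∫ y, g (w y.1) ∂(jointLaw μ ν) = ∫ x, g (w x) ∂μ :=
      (integral_fun_fst (fun x => g (w x))).trans (by simp)
    rw [e] at this
    simpa [φ, interp] using this
  have hstart : |φ 0 - ∫ z, g z ∂ν| ≤ B * m := by
    have := abs_integral_add_smul_sub_le (μ := μ) (ν := ν) b hg hl tempered_snd_fst hB.le
    have e : ∫ y, g y.2.1 ∂(jointLaw μ ν) = ∫ z, g z ∂ν := by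
      refine (integral_fun_snd (μ := μ) (ν := ν.prod (stdGaussian M)) (fun z => g z.1)).trans ?_
      rw [integral_fun_fst (μ := ν) (ν := stdGaussian M) g]
      simp
    rw [e] at this
    simpa [φ, interp] using this
  -- The path of length $\pi/2\le2$ contributes $2mB$; with the two ends this makes the constant 4.
  have hpi : m * B * (Real.pi / 2) ≤ m * B * 2 := by
    gcongr
    linarith [Real.pi_le_four]
  rw [abs_le] at *
  constructor <;> linarith [hmv.1, hmv.2, hend.1, hend.2, hstart.1, hstart.2]

/-- Quantitative normal approximation, in Wasserstein distance, of a random vector `w` admitting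
a Stein kernel `T` with respect to Gaussian integration by parts. No invertibility of the
covariance of the limit `ν` is required. -/
theorem abs_integral_sub_integral_le [Nonempty ι] (hμ : ∫ x, x ∂μ = 0) (hν : ∫ x, x ∂ν = 0)
    (b : OrthonormalBasis ι ℝ M) {w : V → M} (hw : TemperedC1 w) {ξ : ι → V → V} {T : ι → V → M}
    (hξ : ∀ a, ∀ h : V × M × M → ℝ, TemperedC1 h →
      ∫ y, inner ℝ (b a) (w y.1) * h y ∂(jointLaw μ ν) =
        ∫ y, fderiv ℝ h y (ξ a y.1, 0) ∂(jointLaw μ ν))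
    (hTd : ∀ a x, fderiv ℝ w x (ξ a x) = T a x) (hT : ∀ a, TemperedC1 (T a)) {B : ℝ} (hB : 0 < B)
    (hTB : ∑ a, ∫ x, ‖T a x - ∫ z, inner ℝ (b a) z • z ∂ν‖ ^ 2 ∂μ ≤ B ^ 4) {g : M → ℝ}
    (hl : LipschitzWith 1 g) :
    |∫ x, g (w x) ∂μ - ∫ z, g z ∂ν| ≤ 4 * √(Fintype.card ι) * B := by
  refine le_of_forall_pos_le_add fun δ hδ => ?_
  -- The bound for the smooth `f` does not involve `K`, so it survives the limit $\delta\to0$.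
  obtain ⟨f, hf, hfl, ⟨K, hK⟩, hfg⟩ := exists_contDiff_approx hl (half_pos hδ)
  have h1 := abs_integral_sub_integral_le_of_contDiff hμ hν b hw hξ hTd hT hB hTB hf hfl hK
  have hfT := TemperedC1.of_lipschitz hf hfl
  have hgb : PolyBounded g := by
    refine (hfT.growth.norm.add (.const (δ / 2))).of_le fun x => ?_
    have := hfg x
    simp only [Real.norm_eq_abs]
    rw [abs_of_nonneg (by positivity : 0 ≤ |f x| + δ / 2)]
    have h3 := abs_sub_abs_le_abs_sub (g x) (f x)
    rw [abs_sub_comm] at h3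
    linarith
  have i1 := (hfT.comp hw).growth.integrable' (μ := μ) (hfT.comp hw).continuous
  have i2 := (hgb.comp hw.growth).integrable' (μ := μ) (hl.continuous.comp hw.continuous)
  have i3 := hfT.growth.integrable' (μ := ν) hfT.continuous
  have i4 := hgb.integrable' (μ := ν) hl.continuous
  have h2 : |∫ x, f (w x) ∂μ - ∫ x, g (w x) ∂μ| ≤ δ / 2 := by
    rw [← integral_sub i1 i2]
    simpa using norm_integral_le_of_norm_le (f := fun x => f (w x) - g (w x))
      (integrable_const (μ := μ) (δ / 2)) (ae_of_all _ fun x => hfg (w x))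
  have h3 : |∫ x, f x ∂ν - ∫ x, g x ∂ν| ≤ δ / 2 := by
    rw [← integral_sub i3 i4]
    simpa using norm_integral_le_of_norm_le (f := fun x => f x - g x)
      (integrable_const (μ := ν) (δ / 2)) (ae_of_all _ fun x => hfg x)
  rw [abs_le] at *
  constructor <;> linarith [h1.1, h1.2, h2.1, h2.2, h3.1, h3.2]

end SteinBound

/-! ### Four-cycle sums and the exponent 4/3. -/

section CycleSum

variable {κ : Type*} [Fintype κ]

lemma prod_le_sum_pow_four (x y z u : ℝ) :
    x * y * z * u ≤ (x ^ 4 + y ^ 4 + z ^ 4 + u ^ 4) / 4 := by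
  nlinarith [sq_nonneg (x * y - z * u), sq_nonneg (x ^ 2 - y ^ 2), sq_nonneg (z ^ 2 - u ^ 2)]

/-- A four-cycle sum of nonnegative symmetric weights is controlled by the row sums of their
`4/3`-th powers. -/
lemma sum_cycle_le {S : κ → κ → ℝ} (hS : ∀ k l, S k l = S l k) {A : ℝ} (hA : 0 ≤ A)
    (hrow : ∀ k, ∑ l, |S k l| ^ (4 / 3 : ℝ) ≤ A) :
    ∑ k, ∑ l, ∑ k', ∑ l', |S k l * S k' l' * (S k k' * S l l')| ≤ Fintype.card κ * A ^ 3 := by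
  -- With $|S|=\alpha^3$, the product over the four edges of the cycle equals the product of four
  -- triples of $\alpha$, each omitting one edge. The arithmetic-geometric mean inequality turns the
  -- triples into fourth powers, and a cycle without an edge is a path.
  let α : κ → κ → ℝ := fun k l => |S k l| ^ (1 / 3 : ℝ)
  have hα : ∀ k l, 0 ≤ α k l := fun k l => by positivity
  have hα3 : ∀ k l, |S k l| = α k l ^ 3 := fun k l => by
    rw [← Real.rpow_natCast, ← Real.rpow_mul (abs_nonneg _)]
    norm_num
  have hα4 : ∀ k l, |S k l| ^ (4 / 3 : ℝ) = α k l ^ 4 := fun k l => by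
    rw [← Real.rpow_natCast, ← Real.rpow_mul (abs_nonneg _)]
    norm_num
  let t : κ → κ → ℝ := fun k l => α k l ^ 4
  have ht : ∀ k l, 0 ≤ t k l := fun k l => by positivity
  have hts : ∀ k l, t k l = t l k := fun k l => by simp only [t, α, hS k l]
  have hrow' : ∀ k, ∑ l, t k l ≤ A := fun k => by
    simpa only [hα4] using hrow k
  have leaf : ∀ {c : ℝ} (_ : 0 ≤ c) (k : κ), ∑ l, c * t k l ≤ c * A := fun hc k => by
    rw [← Finset.mul_sum]
    exact mul_le_mul_of_nonneg_left (hrow' k) hc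
  -- The end vertex of the path is summed out three times, each at the cost of a row sum `A`; the
  -- remaining vertex gives the cardinality.
  have path : ∑ a, ∑ b, ∑ c, ∑ d, t a b * t b c * t c d ≤ Fintype.card κ * A ^ 3 := by
    calc ∑ a, ∑ b, ∑ c, ∑ d, t a b * t b c * t c d
        ≤ ∑ a, ∑ b, ∑ c, A * t a b * t b c := by
          refine Finset.sum_le_sum fun a _ => Finset.sum_le_sum fun b _ =>
            Finset.sum_le_sum fun c _ => (leaf (mul_nonneg (ht _ _) (ht _ _)) c).trans_eq ?_
          ring
      _ ≤ ∑ a, ∑ b, A ^ 2 * t a b := by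
          refine Finset.sum_le_sum fun a _ => Finset.sum_le_sum fun b _ =>
            (leaf (mul_nonneg hA (ht _ _)) b).trans_eq ?_
          ring
      _ ≤ ∑ _a : κ, A ^ 3 := by
          refine Finset.sum_le_sum fun a _ => (leaf (by positivity) a).trans_eq ?_
          ring
      _ = _ := by simp
  -- `p1` to `p4` are the four ways of omitting an edge, relabelled as the path above.
  have p1 : ∑ k, ∑ l, ∑ k', ∑ l', t k l * t k' l' * t k k' ≤ Fintype.card κ * A ^ 3 := by
    refine le_of_eq_of_le ?_ path
    rw [Finset.sum_comm]
    refine Finset.sum_congr rfl fun l _ => Finset.sum_congr rfl fun k _ =>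
      Finset.sum_congr rfl fun k' _ => Finset.sum_congr rfl fun l' _ => ?_
    rw [hts k l]
    ring
  have p2 : ∑ k, ∑ l, ∑ k', ∑ l', t k l * t k' l' * t l l' ≤ Fintype.card κ * A ^ 3 := by
    refine le_of_eq_of_le ?_ path
    refine Finset.sum_congr rfl fun k _ => Finset.sum_congr rfl fun l _ => ?_
    rw [Finset.sum_comm]
    refine Finset.sum_congr rfl fun l' _ => Finset.sum_congr rfl fun k' _ => ?_
    rw [hts k' l']
    ring
  have p3 : ∑ k, ∑ l, ∑ k', ∑ l', t k l * t k k' * t l l' ≤ Fintype.card κ * A ^ 3 := by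
    refine le_of_eq_of_le ?_ path
    have e1 : ∑ k, ∑ l, ∑ k', ∑ l', t k l * t k k' * t l l' =
        ∑ k, ∑ k', ∑ l, ∑ l', t k l * t k k' * t l l' :=
      Finset.sum_congr rfl fun k _ => Finset.sum_comm
    rw [e1, Finset.sum_comm]
    refine Finset.sum_congr rfl fun k' _ => Finset.sum_congr rfl fun k _ =>
      Finset.sum_congr rfl fun l _ => Finset.sum_congr rfl fun l' _ => ?_
    rw [hts k k']
    ring
  have p4 : ∑ k, ∑ l, ∑ k', ∑ l', t k' l' * t k k' * t l l' ≤ Fintype.card κ * A ^ 3 := by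
    refine le_of_eq_of_le ?_ path
    refine Finset.sum_congr rfl fun k _ => ?_
    rw [Finset.sum_comm]
    refine Finset.sum_congr rfl fun k' _ => ?_
    rw [Finset.sum_comm]
    refine Finset.sum_congr rfl fun l' _ => Finset.sum_congr rfl fun l _ => ?_
    rw [hts l l']
    ring
  have hpt : ∀ k l k' l', |S k l * S k' l' * (S k k' * S l l')| ≤
      (t k l * t k' l' * t k k' + t k l * t k' l' * t l l' + t k l * t k k' * t l l' +
        t k' l' * t k k' * t l l') / 4 := fun k l k' l' => by
    have := prod_le_sum_pow_four (α k l * α k' l' * α k k') (α k l * α k' l' * α l l')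
      (α k l * α k k' * α l l') (α k' l' * α k k' * α l l')
    rw [abs_mul, abs_mul, abs_mul, hα3, hα3, hα3, hα3]
    refine le_of_eq_of_le ?_ (this.trans_eq ?_)
    · ring
    · simp only [t]
      ring
  have := Finset.sum_le_sum fun k (_ : k ∈ Finset.univ) => Finset.sum_le_sum fun l
    (_ : l ∈ Finset.univ) => Finset.sum_le_sum fun k' (_ : k' ∈ Finset.univ) =>
    Finset.sum_le_sum fun l' (_ : l' ∈ Finset.univ) => hpt k l k' l'
  refine this.trans ?_
  simp only [← Finset.sum_div, Finset.sum_add_distrib]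
  linarith

end CycleSum

/-! ### Wick's formula and fourth moments. -/

section Wick

variable {κ : Type*} [Fintype κ] {μ : Measure (κ → ℝ)} [IsGaussian μ]

lemma tempered_coord (p : κ) : TemperedC1 (fun x : κ → ℝ => x p) :=
  TemperedC1.clm (ContinuousLinearMap.proj (R := ℝ) (φ := fun _ : κ => ℝ) p)

lemma TemperedC1.integrable {E F : Type*} [NormedAddCommGroup E] [NormedSpace ℝ E]
    [CompleteSpace E] [SecondCountableTopology E] [MeasurableSpace E] [BorelSpace E]
    [NormedAddCommGroup F] [NormedSpace ℝ F] {m : Measure E} [IsGaussian m] {f : E → F}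
    (hf : TemperedC1 f) : Integrable f m :=
  hf.growth.integrable' hf.continuous

lemma integral_coord_smul {K : κ → κ → ℝ} (hK : ∀ p q, ∫ x, x p * x q ∂μ = K p q) (p : κ) :
    ∫ x, x p • x ∂μ = K p := by
  ext q
  rw [← hK]
  have := (ContinuousLinearMap.proj (R := ℝ) (φ := fun _ : κ => ℝ) q).integral_comp_comm
    (integrable_dual_smul (μ := μ) (ContinuousLinearMap.proj (R := ℝ) (φ := fun _ : κ => ℝ) p))
  simpa using this.symm

/-- Wick's formula for fourth moments. -/
lemma integral_four_coords (hμ : ∫ x, x ∂μ = 0) {K : κ → κ → ℝ}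
    (hK : ∀ p q, ∫ x, x p * x q ∂μ = K p q) (p q p' q' : κ) :
    ∫ x, x p * (x q * (x p' * x q')) ∂μ =
      K p q * K p' q' + K p p' * K q q' + K p q' * K q p' := by
  have hd : ∀ a, ∀ x : κ → ℝ, HasFDerivAt (fun x : κ → ℝ => x a)
      (ContinuousLinearMap.proj (R := ℝ) (φ := fun _ : κ => ℝ) a) x := fun a x =>
    (ContinuousLinearMap.proj (R := ℝ) (φ := fun _ : κ => ℝ) a).hasFDerivAt
  have h := integral_dual_mul_eq hμ (ContinuousLinearMap.proj (R := ℝ) (φ := fun _ : κ => ℝ) p)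
    ((tempered_coord q).mul ((tempered_coord p').mul (tempered_coord q')))
  simp only [ContinuousLinearMap.proj_apply] at h
  rw [h, integral_coord_smul hK]
  have e : ∀ x : κ → ℝ, fderiv ℝ (fun x : κ → ℝ => x q * (x p' * x q')) x (K p) =
      K p q * (x p' * x q') + K p p' * (x q * x q') + K p q' * (x q * x p') := fun x => by
    rw [((hd q x).fun_mul ((hd p' x).fun_mul (hd q' x))).fderiv]
    simp
    ring
  have hi : ∀ a b, Integrable (fun x : κ → ℝ => x a * x b) μ := fun a b =>
    ((tempered_coord a).mul (tempered_coord b)).integrable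
  have i1 : Integrable (fun x : κ → ℝ => K p q * (x p' * x q') + K p p' * (x q * x q')) μ :=
    ((hi _ _).const_mul _).add ((hi _ _).const_mul _)
  simp_rw [e]
  rw [integral_add i1 ((hi _ _).const_mul _),
    integral_add ((hi _ _).const_mul _) ((hi _ _).const_mul _)]
  simp only [integral_const_mul, hK]

/-- Centering removes the pairing within each factor and leaves the two crossed pairings. -/
lemma integral_centered_mul_centered (hμ : ∫ x, x ∂μ = 0) {K : κ → κ → ℝ}
    (hK : ∀ p q, ∫ x, x p * x q ∂μ = K p q) (p q p' q' : κ) :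
    ∫ x, (x p * x q - K p q) * (x p' * x q' - K p' q') ∂μ =
      K p p' * K q q' + K p q' * K q p' := by
  have hi : ∀ a b, Integrable (fun x : κ → ℝ => x a * x b) μ := fun a b =>
    ((tempered_coord a).mul (tempered_coord b)).integrable
  have hi4 : Integrable (fun x : κ → ℝ => x p * (x q * (x p' * x q'))) μ :=
    ((tempered_coord p).mul ((tempered_coord q).mul
      ((tempered_coord p').mul (tempered_coord q')))).integrable
  have e : ∀ x : κ → ℝ, (x p * x q - K p q) * (x p' * x q' - K p' q') =
      x p * (x q * (x p' * x q')) - K p' q' * (x p * x q) - K p q * (x p' * x q') +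
        K p q * K p' q' := fun x => by ring
  have i1 : Integrable (fun x : κ → ℝ => x p * (x q * (x p' * x q')) -
      K p' q' * (x p * x q)) μ := hi4.sub ((hi _ _).const_mul _)
  have i2 : Integrable (fun x : κ → ℝ => x p * (x q * (x p' * x q')) -
      K p' q' * (x p * x q) - K p q * (x p' * x q')) μ := i1.sub ((hi _ _).const_mul _)
  simp_rw [e]
  rw [integral_add i2 (integrable_const _), integral_sub i1 ((hi _ _).const_mul _),
    integral_sub hi4 ((hi _ _).const_mul _), integral_four_coords hμ hK]
  simp only [integral_const_mul, hK, integral_const, probReal_univ, one_smul]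
  ring

lemma TemperedC1.of_coord {E ι : Type*} [NormedAddCommGroup E] [NormedSpace ℝ E] [Fintype ι]
    {f : E → EuclideanSpace ℝ ι} (hf : ∀ a, TemperedC1 (fun x => f x a)) : TemperedC1 f := by
  classical
  have e : f = fun x => ∑ a, f x a • EuclideanSpace.basisFun ι ℝ a := funext fun x => by
    conv_lhs => rw [← (EuclideanSpace.basisFun ι ℝ).sum_repr (f x)]
    simp
  rw [e]
  exact .sum _ fun a => (hf a).smul (.const _)

end Wick

/-! ### The Stein kernel of the Wishart matrix and its variance. -/

section Wishart

variable {ι τ : Type*} [Fintype ι] [Fintype τ]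

/-- The normalised centered Wishart matrix, as a quadratic function of the data `x`, with row
covariances `R`. -/
noncomputable def wishartMap (R : ι → ι → ℝ) (x : ι × τ → ℝ) : EuclideanSpace ℝ (ι × ι) :=
  WithLp.toLp 2 fun a => (√(Fintype.card τ))⁻¹ * ∑ k, (x (a.1, k) * x (a.2, k) - R a.1 a.2)

/-- The quadratic form `∑_{k,l} S(k,l) (x_{jk} x_{vl} - R(j,v) S(k,l))`. -/
noncomputable def centeredForm (R : ι → ι → ℝ) (S : τ → τ → ℝ) (j v : ι) (x : ι × τ → ℝ) : ℝ :=
  ∑ k, ∑ l, S k l * (x (j, k) * x (v, l) - R j v * S k l)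

/-- The covariance of the entries of the Wishart matrix. -/
noncomputable def wishartCov (R : ι → ι → ℝ) (S : τ → τ → ℝ) (a b : ι × ι) : ℝ :=
  (Fintype.card τ : ℝ)⁻¹ * ∑ k, ∑ l, S k l ^ 2 *
    (R a.1 b.1 * R a.2 b.2 + R a.1 b.2 * R a.2 b.1)

/-- The Stein kernel of the Wishart matrix. -/
noncomputable def wishartKernel (R : ι → ι → ℝ) (S : τ → τ → ℝ) (a : ι × ι) (x : ι × τ → ℝ) :
    EuclideanSpace ℝ (ι × ι) :=
  WithLp.toLp 2 fun b => (Fintype.card τ : ℝ)⁻¹ *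
    (R a.1 b.1 * centeredForm R S a.2 b.2 x + R a.1 b.2 * centeredForm R S a.2 b.1 x) +
      wishartCov R S a b

/-- The vector field dual to an entry of the Wishart matrix. -/
noncomputable def wishartField (R : ι → ι → ℝ) (S : τ → τ → ℝ) (a : ι × ι) (x : ι × τ → ℝ) :
    ι × τ → ℝ :=
  (√(Fintype.card τ))⁻¹ • ∑ k, x (a.2, k) • fun q : ι × τ => R a.1 q.1 * S k q.2

lemma tempered_wishartMap (R : ι → ι → ℝ) : TemperedC1 (wishartMap (τ := τ) R) :=
  .of_coord fun _ => (TemperedC1.sum _ fun _ =>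
    ((tempered_coord _).mul (tempered_coord _)).sub (.const _)).const_mul _

lemma tempered_centeredForm (R : ι → ι → ℝ) (S : τ → τ → ℝ) (j v : ι) :
    TemperedC1 (centeredForm R S j v) :=
  .sum _ fun _ => .sum _ fun _ =>
    (((tempered_coord _).mul (tempered_coord _)).sub (.const _)).const_mul _

lemma tempered_wishartKernel (R : ι → ι → ℝ) (S : τ → τ → ℝ) (a : ι × ι) :
    TemperedC1 (wishartKernel R S a) :=
  .of_coord fun _ => ((((tempered_centeredForm R S _ _).const_mul _).add
    ((tempered_centeredForm R S _ _).const_mul _)).const_mul _).add (.const _)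

lemma fderiv_wishartMap_apply (R : ι → ι → ℝ) (x v : ι × τ → ℝ) (b : ι × ι) :
    fderiv ℝ (wishartMap R) x v b = (√(Fintype.card τ))⁻¹ *
      ∑ l, (x (b.1, l) * v (b.2, l) + x (b.2, l) * v (b.1, l)) := by
  have hd : ∀ p, HasFDerivAt (fun x : ι × τ → ℝ => x p)
      (ContinuousLinearMap.proj (R := ℝ) (φ := fun _ : ι × τ => ℝ) p) x := fun p =>
    (ContinuousLinearMap.proj (R := ℝ) (φ := fun _ : ι × τ => ℝ) p).hasFDerivAt
  have h1 : HasFDerivAt (fun x : ι × τ → ℝ => wishartMap R x b) _ x :=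
    (HasFDerivAt.fun_sum (u := Finset.univ) fun l _ =>
      ((hd (b.1, l)).fun_mul (hd (b.2, l))).sub_const (R b.1 b.2)).const_mul
        ((√(Fintype.card τ : ℝ))⁻¹)
  have h2 : HasFDerivAt (fun x : ι × τ → ℝ => wishartMap R x b)
      ((EuclideanSpace.proj (𝕜 := ℝ) b).comp (fderiv ℝ (wishartMap R) x)) x :=
    (EuclideanSpace.proj (𝕜 := ℝ) b).hasFDerivAt.comp x
      ((tempered_wishartMap R).differentiable x).hasFDerivAt
  have h3 := congrArg (fun L : (ι × τ → ℝ) →L[ℝ] ℝ => L v) (h2.unique h1)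
  simpa using h3

/-- The constants subtracted in the two centered forms add up to exactly `wishartCov`. -/
lemma fderiv_wishartMap_wishartField [Nonempty τ] (R : ι → ι → ℝ) (S : τ → τ → ℝ) (a : ι × ι)
    (x : ι × τ → ℝ) :
    fderiv ℝ (wishartMap R) x (wishartField R S a x) = wishartKernel R S a x := by
  ext b
  rw [fderiv_wishartMap_apply]
  have hd : (0 : ℝ) < Fintype.card τ := by exact_mod_cast Fintype.card_pos
  have e : ∀ p : ι × τ, wishartField R S a x p =
      (√(Fintype.card τ))⁻¹ * ∑ k, x (a.2, k) * (R a.1 p.1 * S k p.2) := fun p => by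
    simp [wishartField]
  have hsq : (√(Fintype.card τ : ℝ))⁻¹ * (√(Fintype.card τ : ℝ))⁻¹ =
      (Fintype.card τ : ℝ)⁻¹ := by
    rw [← mul_inv, Real.mul_self_sqrt hd.le]
  simp only [e, wishartKernel, wishartCov, centeredForm]
  rw [← hsq]
  simp only [Finset.mul_sum, ← Finset.sum_add_distrib]
  rw [Finset.sum_comm]
  refine Finset.sum_congr rfl fun k _ => Finset.sum_congr rfl fun l _ => ?_
  ring

variable {μ : Measure (ι × τ → ℝ)} [IsGaussian μ]

/-- Only the factor $x_{a_1k}$ is integrated by parts. Differentiating the other factor $x_{a_2k}$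
produces $R(a_1,a_2)S(k,k)=R(a_1,a_2)$, which cancels the centering. -/
lemma integral_wishartMap_mul (hμ : ∫ x, x ∂μ = 0) {R : ι → ι → ℝ} {S : τ → τ → ℝ}
    (hS : ∀ k, S k k = 1) (hK : ∀ p q, ∫ x, x p * x q ∂μ = R p.1 q.1 * S p.2 q.2) (a : ι × ι)
    {B : Type*} [NormedAddCommGroup B] [NormedSpace ℝ B] [CompleteSpace B]
    [SecondCountableTopology B] [MeasurableSpace B] [BorelSpace B] {ν : Measure B} [IsGaussian ν]
    (hν : ∫ z, z ∂ν = 0) {h : (ι × τ → ℝ) × B → ℝ} (hh : TemperedC1 h) :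
    ∫ y, wishartMap R y.1 a * h y ∂(μ.prod ν) =
      ∫ y, fderiv ℝ h y (wishartField R S a y.1, 0) ∂(μ.prod ν) := by
  let K : ι × τ → ι × τ → ℝ := fun p q => R p.1 q.1 * S p.2 q.2
  have hc : ∀ p : ι × τ, TemperedC1 (fun y : (ι × τ → ℝ) × B => y.1 p) := fun p =>
    (tempered_coord p).comp (TemperedC1.clm (ContinuousLinearMap.fst ℝ (ι × τ → ℝ) B))
  have hxi : ∀ p q, Integrable (fun y => y.1 p * fderiv ℝ h y (K q, 0)) (μ.prod ν) :=
    fun p q => ((hc p).growth.mul (hh.growth_fderiv.clm_apply (.const _))).integrable'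
      ((hc p).continuous.mul (hh.continuous_fderiv.clm_apply continuous_const))
  have key : ∀ k, ∫ y, (y.1 (a.1, k) * y.1 (a.2, k) - R a.1 a.2) * h y ∂(μ.prod ν) =
      ∫ y, y.1 (a.2, k) * fderiv ℝ h y (K (a.1, k), 0) ∂(μ.prod ν) := fun k => by
    have h1 := integral_dual_fst_mul_eq hμ hν
      (ContinuousLinearMap.proj (R := ℝ) (φ := fun _ : ι × τ => ℝ) (a.1, k))
      ((hc (a.2, k)).mul hh)
    simp only [ContinuousLinearMap.proj_apply] at h1
    rw [integral_coord_smul (K := K) hK] at h1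
    have e : ∀ y : (ι × τ → ℝ) × B,
        fderiv ℝ (fun y => y.1 (a.2, k) * h y) y (K (a.1, k), 0) =
          y.1 (a.2, k) * fderiv ℝ h y (K (a.1, k), 0) + R a.1 a.2 * h y := fun y => by
      have h3 : HasFDerivAt (fun y : (ι × τ → ℝ) × B => y.1 (a.2, k))
          ((ContinuousLinearMap.proj (R := ℝ) (φ := fun _ : ι × τ => ℝ) (a.2, k)).comp
            (ContinuousLinearMap.fst ℝ (ι × τ → ℝ) B)) y :=
        ((ContinuousLinearMap.proj (R := ℝ) (φ := fun _ : ι × τ => ℝ) (a.2, k)).comp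
          (ContinuousLinearMap.fst ℝ (ι × τ → ℝ) B)).hasFDerivAt
      rw [(h3.fun_mul (hh.differentiable y).hasFDerivAt).fderiv]
      simp [K, hS]
      ring
    simp_rw [e] at h1
    rw [integral_add (hxi _ _) (hh.integrable.const_mul _)] at h1
    have e2 : ∀ y : (ι × τ → ℝ) × B, (y.1 (a.1, k) * y.1 (a.2, k) - R a.1 a.2) * h y =
        y.1 (a.1, k) * (y.1 (a.2, k) * h y) - R a.1 a.2 * h y := fun y => by ring
    simp_rw [e2]
    rw [integral_sub ((hc _).mul ((hc _).mul hh)).integrable (hh.integrable.const_mul _), h1]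
    ring
  have e1 : ∀ y : (ι × τ → ℝ) × B, wishartMap R y.1 a * h y = (√(Fintype.card τ))⁻¹ *
      ∑ k, (y.1 (a.1, k) * y.1 (a.2, k) - R a.1 a.2) * h y := fun y => by
    simp only [wishartMap, ← Finset.sum_mul]
    ring
  have e2 : ∀ y : (ι × τ → ℝ) × B, fderiv ℝ h y (wishartField R S a y.1, 0) =
      (√(Fintype.card τ))⁻¹ * ∑ k, y.1 (a.2, k) * fderiv ℝ h y (K (a.1, k), 0) := fun y => by
    have e3 : (wishartField R S a y.1, (0 : B)) = (√(Fintype.card τ : ℝ))⁻¹ •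
        ∑ k, y.1 (a.2, k) • ((K (a.1, k), 0) : (ι × τ → ℝ) × B) := by
      ext1
      · simp [wishartField, K, Prod.fst_sum]
      · simp [Prod.snd_sum]
    rw [e3]
    simp only [map_smul, map_sum, smul_eq_mul]
  simp_rw [e1, e2, integral_const_mul]
  congr 1
  rw [integral_finsetSum _ fun k _ => hxi _ _, integral_finsetSum _ fun k _ => ?_]
  · exact Finset.sum_congr rfl fun k _ => key k
  · exact ((((hc _).mul (hc _)).sub (.const _)).mul hh).integrable

lemma integral_wishartMap_mul_wishartMap [Nonempty τ] (hμ : ∫ x, x ∂μ = 0) {R : ι → ι → ℝ}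
    {S : τ → τ → ℝ} (hS : ∀ k, S k k = 1)
    (hK : ∀ p q, ∫ x, x p * x q ∂μ = R p.1 q.1 * S p.2 q.2) (a b : ι × ι) :
    ∫ x, wishartMap R x a * wishartMap R x b ∂μ = wishartCov R S a b := by
  have hd : (0 : ℝ) < Fintype.card τ := by exact_mod_cast Fintype.card_pos
  have hsq : (√(Fintype.card τ : ℝ))⁻¹ * (√(Fintype.card τ : ℝ))⁻¹ =
      (Fintype.card τ : ℝ)⁻¹ := by
    rw [← mul_inv, Real.mul_self_sqrt hd.le]
  have e : ∀ x : ι × τ → ℝ, wishartMap R x a * wishartMap R x b = (Fintype.card τ : ℝ)⁻¹ *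
      ∑ k, ∑ l, (x (a.1, k) * x (a.2, k) - R a.1 a.2) *
        (x (b.1, l) * x (b.2, l) - R b.1 b.2) := fun x => by
    rw [← hsq, ← Finset.sum_mul_sum]
    simp only [wishartMap]
    ring
  have hT : ∀ k l, TemperedC1 (fun x : ι × τ → ℝ =>
      (x (a.1, k) * x (a.2, k) - R a.1 a.2) * (x (b.1, l) * x (b.2, l) - R b.1 b.2)) :=
    fun k l => (((tempered_coord _).mul (tempered_coord _)).sub (.const _)).mul
      (((tempered_coord _).mul (tempered_coord _)).sub (.const _))
  simp_rw [e, integral_const_mul, wishartCov]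
  congr 1
  rw [integral_finsetSum _ fun k _ => (TemperedC1.sum _ fun l => hT k l).integrable]
  refine Finset.sum_congr rfl fun k _ => ?_
  rw [integral_finsetSum _ fun l _ => (hT k l).integrable]
  refine Finset.sum_congr rfl fun l _ => ?_
  have := integral_centered_mul_centered (K := fun p q => R p.1 q.1 * S p.2 q.2) hμ hK
    (a.1, k) (a.2, k) (b.1, l) (b.2, l)
  simp only [hS, mul_one] at this
  rw [this]
  ring

/-- In the expanded square each of the two crossed pairings is a four-cycle sum in `S` times a
product of entries of `R` bounded by 1. The second becomes the first after exchanging $k'$ and $l'$,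
by symmetry of `S`. -/
lemma integral_centeredForm_sq_le (hμ : ∫ x, x ∂μ = 0) {R : ι → ι → ℝ} {S : τ → τ → ℝ}
    (hSs : ∀ k l, S k l = S l k) (hR : ∀ i j, |R i j| ≤ 1)
    (hK : ∀ p q, ∫ x, x p * x q ∂μ = R p.1 q.1 * S p.2 q.2) {A : ℝ} (hA : 0 ≤ A)
    (hrow : ∀ k, ∑ l, |S k l| ^ (4 / 3 : ℝ) ≤ A) (j v : ι) :
    ∫ x, centeredForm R S j v x ^ 2 ∂μ ≤ 2 * (Fintype.card τ * A ^ 3) := by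
  have e : ∀ x : ι × τ → ℝ, centeredForm R S j v x ^ 2 = ∑ k, ∑ l, ∑ k', ∑ l',
      S k l * S k' l' * ((x (j, k) * x (v, l) - R j v * S k l) *
        (x (j, k') * x (v, l') - R j v * S k' l')) := fun x => by
    simp only [centeredForm, pow_two, Finset.sum_mul, Finset.mul_sum]
    refine Finset.sum_congr rfl fun k _ => Finset.sum_congr rfl fun l _ =>
      Finset.sum_congr rfl fun k' _ => Finset.sum_congr rfl fun l' _ => ?_
    ring
  have hT : ∀ k l k' l', TemperedC1 (fun x : ι × τ → ℝ => S k l * S k' l' *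
      ((x (j, k) * x (v, l) - R j v * S k l) * (x (j, k') * x (v, l') - R j v * S k' l'))) :=
    fun k l k' l' => ((((tempered_coord _).mul (tempered_coord _)).sub (.const _)).mul
      (((tempered_coord _).mul (tempered_coord _)).sub (.const _))).const_mul _
  have hval : ∀ k l k' l', ∫ x, S k l * S k' l' * ((x (j, k) * x (v, l) - R j v * S k l) *
      (x (j, k') * x (v, l') - R j v * S k' l')) ∂μ ≤
        |S k l * S k' l' * (S k k' * S l l')| + |S k l * S l' k' * (S k l' * S l k')| :=
    fun k l k' l' => by
      have := integral_centered_mul_centered (K := fun p q => R p.1 q.1 * S p.2 q.2) hμ hK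
        (j, k) (v, l) (j, k') (v, l')
      simp only at this
      rw [integral_const_mul, this, mul_add]
      have hRR : ∀ a b c d, |R a b * R c d| ≤ 1 := fun a b c d => by
        rw [abs_mul]
        exact mul_le_one₀ (hR _ _) (abs_nonneg _) (hR _ _)
      refine add_le_add ?_ ?_
      · refine (le_abs_self _).trans ?_
        rw [show S k l * S k' l' * (R j j * S k k' * (R v v * S l l')) =
          (R j j * R v v) * (S k l * S k' l' * (S k k' * S l l')) by ring, abs_mul]
        exact mul_le_of_le_one_left (abs_nonneg _) (hRR _ _ _ _)
      · refine (le_abs_self _).trans ?_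
        rw [show S k l * S k' l' * (R j v * S k l' * (R v j * S l k')) =
          (R j v * R v j) * (S k l * S l' k' * (S k l' * S l k')) by rw [hSs l' k']; ring, abs_mul]
        exact mul_le_of_le_one_left (abs_nonneg _) (hRR _ _ _ _)
  simp_rw [e]
  rw [integral_finsetSum _ fun k _ => (TemperedC1.sum _ fun l => .sum _ fun k' =>
    .sum _ fun l' => hT k l k' l').integrable]
  have hstep : ∀ k, ∫ x, ∑ l, ∑ k', ∑ l', S k l * S k' l' *
      ((x (j, k) * x (v, l) - R j v * S k l) * (x (j, k') * x (v, l') - R j v * S k' l')) ∂μ ≤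
      ∑ l, ∑ k', ∑ l', |S k l * S k' l' * (S k k' * S l l')| +
        ∑ l, ∑ k', ∑ l', |S k l * S l' k' * (S k l' * S l k')| := fun k => by
    rw [integral_finsetSum _ fun l _ => (TemperedC1.sum _ fun k' =>
      .sum _ fun l' => hT k l k' l').integrable, ← Finset.sum_add_distrib]
    refine Finset.sum_le_sum fun l _ => ?_
    rw [integral_finsetSum _ fun k' _ => (TemperedC1.sum _ fun l' => hT k l k' l').integrable,
      ← Finset.sum_add_distrib]
    refine Finset.sum_le_sum fun k' _ => ?_
    rw [integral_finsetSum _ fun l' _ => (hT k l k' l').integrable, ← Finset.sum_add_distrib]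
    exact Finset.sum_le_sum fun l' _ => hval k l k' l'
  refine (Finset.sum_le_sum fun k _ => hstep k).trans ?_
  rw [Finset.sum_add_distrib]
  have c1 := sum_cycle_le hSs hA hrow
  have c2 : ∑ k, ∑ l, ∑ k', ∑ l', |S k l * S l' k' * (S k l' * S l k')| ≤
      Fintype.card τ * A ^ 3 := by
    refine le_of_eq_of_le ?_ c1
    exact Finset.sum_congr rfl fun k _ => Finset.sum_congr rfl fun l _ => Finset.sum_comm
  linarith

/-- Two forms, each of second moment at most $2dA^3$, enter with the factor $d^{-2}$;
$(u+w)^2\le2(u^2+w^2)$ gives $8=2(2+2)$. -/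
lemma integral_wishartKernel_sub_sq_le [Nonempty τ] (hμ : ∫ x, x ∂μ = 0) {R : ι → ι → ℝ}
    {S : τ → τ → ℝ} (hSs : ∀ k l, S k l = S l k) (hR : ∀ i j, |R i j| ≤ 1)
    (hK : ∀ p q, ∫ x, x p * x q ∂μ = R p.1 q.1 * S p.2 q.2) {A : ℝ} (hA : 0 ≤ A)
    (hrow : ∀ k, ∑ l, |S k l| ^ (4 / 3 : ℝ) ≤ A) (a b : ι × ι) :
    ∫ x, (wishartKernel R S a x b - wishartCov R S a b) ^ 2 ∂μ ≤
      8 * A ^ 3 / Fintype.card τ := by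
  have hd : (0 : ℝ) < Fintype.card τ := by exact_mod_cast Fintype.card_pos
  set d : ℝ := (Fintype.card τ : ℝ) with hd_def
  have hi : ∀ j v, Integrable (fun x => centeredForm R S j v x ^ 2) μ := fun j v => by
    simp_rw [pow_two]
    exact ((tempered_centeredForm R S j v).mul (tempered_centeredForm R S j v)).integrable
  have hpt : ∀ x, (wishartKernel R S a x b - wishartCov R S a b) ^ 2 ≤
      2 * (d⁻¹) ^ 2 * (centeredForm R S a.2 b.2 x ^ 2 + centeredForm R S a.2 b.1 x ^ 2) :=
    fun x => by
      have h1 := sq_le_one_iff_abs_le_one _ |>.2 (hR a.1 b.1)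
      have h2 := sq_le_one_iff_abs_le_one _ |>.2 (hR a.1 b.2)
      set u := centeredForm R S a.2 b.2 x
      set w := centeredForm R S a.2 b.1 x
      have e : (wishartKernel R S a x b - wishartCov R S a b) ^ 2 =
          (d⁻¹) ^ 2 * (R a.1 b.1 * u + R a.1 b.2 * w) ^ 2 := by
        simp only [wishartKernel]
        ring
      rw [e, show 2 * (d⁻¹) ^ 2 * (u ^ 2 + w ^ 2) = (d⁻¹) ^ 2 * (2 * (u ^ 2 + w ^ 2)) by ring]
      refine mul_le_mul_of_nonneg_left ?_ (by positivity)
      have h3 : R a.1 b.1 ^ 2 * u ^ 2 ≤ u ^ 2 := mul_le_of_le_one_left (sq_nonneg _) h1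
      have h4 : R a.1 b.2 ^ 2 * w ^ 2 ≤ w ^ 2 := mul_le_of_le_one_left (sq_nonneg _) h2
      nlinarith [sq_nonneg (R a.1 b.1 * u - R a.1 b.2 * w)]
  have hint : Integrable (fun x => (wishartKernel R S a x b - wishartCov R S a b) ^ 2) μ := by
    have := ((tempered_wishartKernel R S a).sub (.const (WithLp.toLp 2 (wishartCov R S a))))
    simp_rw [pow_two]
    exact ((this.clm_comp (EuclideanSpace.proj (𝕜 := ℝ) b)).mul
      (this.clm_comp (EuclideanSpace.proj (𝕜 := ℝ) b))).integrable
  refine (integral_mono hint (((hi _ _).add (hi _ _)).const_mul _) hpt).trans ?_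
  simp only [Pi.add_apply]
  rw [integral_const_mul, integral_add (hi _ _) (hi _ _)]
  have q1 := integral_centeredForm_sq_le hμ hSs hR hK hA hrow a.2 b.2
  have q2 := integral_centeredForm_sq_le hμ hSs hR hK hA hrow a.2 b.1
  calc _ ≤ 2 * (d⁻¹) ^ 2 * (2 * (d * A ^ 3) + 2 * (d * A ^ 3)) := by gcongr
    _ = _ := by
      field_simp
      ring

/-- Wasserstein bound for the normal approximation of a Wishart matrix with correlated data. -/
theorem abs_integral_wishartMap_sub_le [Nonempty ι] [Nonempty τ]
    (hμ : ∫ x, x ∂μ = 0) {R : ι → ι → ℝ}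
    {S : τ → τ → ℝ} (hSs : ∀ k l, S k l = S l k) (hS : ∀ k, S k k = 1) (hR : ∀ i j, |R i j| ≤ 1)
    (hK : ∀ p q, ∫ x, x p * x q ∂μ = R p.1 q.1 * S p.2 q.2) {A : ℝ} (hA : 0 < A)
    (hrow : ∀ k, ∑ l, |S k l| ^ (4 / 3 : ℝ) ≤ A) {ν : Measure (EuclideanSpace ℝ (ι × ι))}
    [IsGaussian ν] (hν : ∫ z, z ∂ν = 0)
    (hcov : ∀ a b, ∫ z, z a * z b ∂ν = ∫ x, wishartMap R x a * wishartMap R x b ∂μ)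
    {g : EuclideanSpace ℝ (ι × ι) → ℝ} (hg : LipschitzWith 1 g) :
    |∫ x, g (wishartMap R x) ∂μ - ∫ z, g z ∂ν| ≤
      8 * ((Fintype.card ι : ℝ) ^ 2 / (Fintype.card τ : ℝ) ^ (1 / 4 : ℝ) * A ^ (3 / 4 : ℝ)) := by
  have hd : (0 : ℝ) < Fintype.card τ := by exact_mod_cast Fintype.card_pos
  have hn : (0 : ℝ) < Fintype.card ι := by exact_mod_cast Fintype.card_pos
  set d : ℝ := (Fintype.card τ : ℝ) with hd_def
  set n : ℝ := (Fintype.card ι : ℝ) with hn_def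
  -- The total discrepancy is at most $8n^4A^3/d$. Rounding 8 up to $16=2^4$ gives this `B`, and
  -- $4\sqrt{n^2}\,B$ produces the final constant 8.
  let B : ℝ := 2 * n / d ^ (1 / 4 : ℝ) * A ^ (3 / 4 : ℝ)
  have hB : 0 < B := by positivity
  have hB4 : B ^ 4 = 16 * n ^ 4 * A ^ 3 / d := by
    have e1 : (d ^ (1 / 4 : ℝ)) ^ 4 = d := by
      rw [← Real.rpow_natCast, ← Real.rpow_mul hd.le]
      norm_num
    have e2 : (A ^ (3 / 4 : ℝ)) ^ 4 = A ^ 3 := by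
      rw [← Real.rpow_natCast, ← Real.rpow_mul hA.le, ← Real.rpow_natCast]
      norm_num
    simp only [B, mul_pow, div_pow, e1, e2]
    ring
  let b := EuclideanSpace.basisFun (ι × ι) ℝ
  have hbi : ∀ a (z : EuclideanSpace ℝ (ι × ι)), inner ℝ (b a) z = z a := fun a z =>
    EuclideanSpace.basisFun_inner ..
  have hc : ∀ a, ∫ z, inner ℝ (b a) z • z ∂ν = WithLp.toLp 2 (wishartCov R S a) := fun a => by
    ext c
    rw [← hbi c, inner_integral_inner_smul]
    simp only [hbi]
    rw [hcov, integral_wishartMap_mul_wishartMap hμ hS hK]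
  have hTB : ∑ a, ∫ x, ‖wishartKernel R S a x - ∫ z, inner ℝ (b a) z • z ∂ν‖ ^ 2 ∂μ ≤ B ^ 4 := by
    have h1 : ∀ a, ∫ x, ‖wishartKernel R S a x - ∫ z, inner ℝ (b a) z • z ∂ν‖ ^ 2 ∂μ ≤
        n ^ 2 * (8 * A ^ 3 / d) := fun a => by
      have hk := ((tempered_wishartKernel R S a).sub (.const (WithLp.toLp 2 (wishartCov R S a))))
      simp_rw [hc, EuclideanSpace.real_norm_sq_eq]
      rw [integral_finsetSum _ fun c _ => ?_]
      · refine (Finset.sum_le_sum fun c _ =>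
          integral_wishartKernel_sub_sq_le hμ hSs hR hK hA.le hrow a c).trans_eq ?_
        simp [n, d, pow_two]
      · simp_rw [pow_two]
        exact ((hk.clm_comp (EuclideanSpace.proj (𝕜 := ℝ) c)).mul
          (hk.clm_comp (EuclideanSpace.proj (𝕜 := ℝ) c))).integrable
    refine (Finset.sum_le_sum fun a _ => h1 a).trans ?_
    rw [hB4, Finset.sum_const, nsmul_eq_mul, Finset.card_univ, Fintype.card_prod, Nat.cast_mul]
    have : 0 ≤ n ^ 4 * A ^ 3 / d := by positivity
    calc n * n * (n ^ 2 * (8 * A ^ 3 / d)) = 8 * (n ^ 4 * A ^ 3 / d) := by ring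
      _ ≤ 16 * (n ^ 4 * A ^ 3 / d) := by linarith
      _ = _ := by ring
  have h0 : ∫ z, z ∂(stdGaussian (EuclideanSpace ℝ (ι × ι))) = 0 := integral_id_stdGaussian
  have := abs_integral_sub_integral_le hμ hν b (tempered_wishartMap R)
    (ξ := wishartField R S) (T := wishartKernel R S)
    (fun a h hh => by
      simp only [hbi]
      exact integral_wishartMap_mul hμ hS hK a (integral_prod_id hν h0) hh)
    (fun a x => fderiv_wishartMap_wishartField R S a x)
    (fun a => tempered_wishartKernel R S a) hB hTB hg
  refine this.trans_eq ?_
  rw [Fintype.card_prod, Nat.cast_mul, Real.sqrt_mul_self hn.le]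
  simp only [B]
  ring

end Wishart

/-! ### Distances between random matrices. -/

section Distances

variable {n : ℕ}

lemma hsNorm_eq_norm (A : Matrix (Fin n) (Fin n) ℝ) :
    hsNorm A = ‖(WithLp.toLp 2 fun p : Fin n × Fin n => A p.1 p.2)‖ := by
  rw [hsNorm, EuclideanSpace.norm_eq, Fintype.sum_prod_type]
  simp

lemma lipschitzWith_of_lipNorm_le {g : Matrix (Fin n) (Fin n) ℝ → ℝ} (hg : lipNorm g ≤ 1) :
    LipschitzWith 1 (fun z : EuclideanSpace ℝ (Fin n × Fin n) =>
      g (Matrix.of fun i j => z (i, j))) := by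
  refine LipschitzWith.of_dist_le_mul fun x y => ?_
  rw [NNReal.coe_one, one_mul, Real.dist_eq, dist_eq_norm]
  let A : Matrix (Fin n) (Fin n) ℝ := Matrix.of fun i j => x (i, j)
  let B : Matrix (Fin n) (Fin n) ℝ := Matrix.of fun i j => y (i, j)
  have hAB : hsNorm (A - B) = ‖x - y‖ := by
    rw [hsNorm_eq_norm]
    rfl
  by_cases h : A = B
  · change |g A - g B| ≤ _
    rw [h, sub_self, abs_zero]
    exact norm_nonneg _
  · have h1 : ENNReal.ofReal (|g A - g B| / hsNorm (A - B)) ≤ 1 :=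
      iSup_le_iff.1 (iSup_le_iff.1 (iSup_le_iff.1 hg A) B) h
    rw [ENNReal.ofReal_le_one, hAB] at h1
    have hpos : 0 < ‖x - y‖ := by
      rw [norm_pos_iff, sub_ne_zero]
      rintro rfl
      exact h rfl
    exact (div_le_one hpos).1 h1

lemma dFM_le_dWass {Ω Ω' : Type*} [MeasurableSpace Ω] [MeasurableSpace Ω'] (P : Measure Ω)
    (X : Ω → Matrix (Fin n) (Fin n) ℝ) (P' : Measure Ω') (Y : Ω' → Matrix (Fin n) (Fin n) ℝ) :
    dFM P X P' Y ≤ dWass P X P' Y :=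
  iSup₂_le fun g hg => le_iSup₂_of_le g (le_add_self.trans hg) le_rfl

end Distances

/-! ### Application to the isonormal process. -/

section Isonormal

variable {H Ω Ω' : Type*} [NormedAddCommGroup H] [InnerProductSpace ℝ H]
  [MeasurableSpace Ω] [MeasurableSpace Ω'] {P : Measure Ω} {P' : Measure Ω'}

lemma hasGaussianLaw_pi_of_process {T κ : Type*} [Fintype κ] {X : T → Ω → ℝ}
    (hX : IsGaussianProcess X P) (f : κ → T) : HasGaussianLaw (fun ω p => X (f p) ω) P := by
  classical
  have h := ((hX.comp_right f).hasGaussianLaw Finset.univ).map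
    (ContinuousLinearMap.pi fun p : κ => ContinuousLinearMap.proj (R := ℝ)
      (φ := fun _ : (Finset.univ : Finset κ) => ℝ) ⟨p, Finset.mem_univ p⟩)
  exact h

/-- For fixed `k` the differences $k-l$ are distinct and lie in $[-d,d]$. -/
lemma sum_rpow_shift_le (s : ℤ → ℝ) (d : ℕ) (k : Fin d) :
    ∑ l : Fin d, |s ((k : ℤ) - (l : ℤ))| ^ (4 / 3 : ℝ) ≤
      ∑ m ∈ Finset.Icc (-(d : ℤ)) (d : ℤ), |s m| ^ (4 / 3 : ℝ) := by
  classical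
  have hinj : Function.Injective fun l : Fin d => (k : ℤ) - (l : ℤ) := fun a b h => by
    ext
    simpa using h
  rw [← Finset.sum_image (s := Finset.univ) (g := fun l : Fin d => (k : ℤ) - (l : ℤ))
    (f := fun m => |s m| ^ (4 / 3 : ℝ)) fun a _ b _ h => hinj h]
  refine Finset.sum_le_sum_of_subset_of_nonneg (fun m hm => ?_) fun _ _ _ => by positivity
  obtain ⟨l, -, rfl⟩ := Finset.mem_image.1 hm
  have h1 := k.2
  have h2 := l.2
  rw [Finset.mem_Icc]
  omega

/-- The Wasserstein bound with the exponent `2` in the dimension, valid for all `r`. -/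
theorem dWass_shiftedWishart_le [IsProbabilityMeasure P'] {r s : ℤ → ℝ} {e : ℕ → ℕ → H}
    {X : H → Ω → ℝ} (hr0 : r 0 = 1) (hs0 : s 0 = 1)
    (he : ∀ i j i' j' : ℕ,
      inner ℝ (e i j) (e i' j') = r ((i : ℤ) - (i' : ℤ)) * s ((j : ℤ) - (j' : ℤ)))
    (hX : IsIsonormal X P) {n d : ℕ} (hn : 1 ≤ n) (hd : 1 ≤ d)
    {G : Ω' → Matrix (Fin n) (Fin n) ℝ}
    (hG : IsGaussianCounterpart P' G P (shiftedWishart r e X n d)) :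
    dWass P (shiftedWishart r e X n d) P' G ≤ ENNReal.ofReal (8 * rate s 2 n d) := by
  have : Nonempty (Fin n) := ⟨⟨0, hn⟩⟩
  have : Nonempty (Fin d) := ⟨⟨0, hd⟩⟩
  let R : Fin n → Fin n → ℝ := fun i j => r ((i : ℤ) - (j : ℤ))
  let S : Fin d → Fin d → ℝ := fun k l => s ((k : ℤ) - (l : ℤ))
  let A : ℝ := ∑ m ∈ Finset.Icc (-(d : ℤ)) (d : ℤ), |s m| ^ (4 / 3 : ℝ)
  have hA : 0 < A := by
    refine Finset.sum_pos' (fun _ _ => by positivity) ⟨0, by simp, by simp [hs0]⟩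
  -- Evenness of `s` on the relevant differences comes from the symmetry of the inner product within
  -- one row, where $r(0)=1$.
  have hSs : ∀ k l, S k l = S l k := fun k l => by
    have h1 := he 0 k 0 l
    have h2 := he 0 l 0 k
    rw [real_inner_comm] at h2
    rw [h1] at h2
    simpa [hr0] using h2
  have hnorm : ∀ i, ‖e i 0‖ = 1 := fun i => by
    have := he i 0 i 0
    rw [real_inner_self_eq_norm_sq] at this
    simp only [sub_self, hr0, hs0, mul_one] at this
    exact (pow_eq_one_iff_of_nonneg (norm_nonneg _) two_ne_zero).1 this
  -- Cauchy–Schwarz for the unit vectors of one column, where $s(0)=1$.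
  have hR : ∀ i j, |R i j| ≤ 1 := fun i j => by
    have := he i 0 j 0
    have h2 := abs_real_inner_le_norm (e i 0) (e j 0)
    rw [this, hnorm, hnorm] at h2
    simpa [hs0] using h2
  let Z : Ω → Fin n × Fin d → ℝ := fun ω p => X (e p.1 p.2) ω
  have hZ : HasGaussianLaw Z P := hasGaussianLaw_pi_of_process hX.gaussian
    fun p : Fin n × Fin d => e p.1 p.2
  let μ := P.map Z
  have : IsGaussian μ := hZ.isGaussian_map
  have hZm : AEMeasurable Z P := hZ.aemeasurable
  have : IsProbabilityMeasure P := hZ.isProbabilityMeasure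
  have hμ : ∫ x, x ∂μ = 0 := by
    ext p
    have h1 := (ContinuousLinearMap.proj (R := ℝ) (φ := fun _ : Fin n × Fin d => ℝ)
      p).integral_comp_comm (IsGaussian.integrable_id (μ := μ))
    simp only [ContinuousLinearMap.proj_apply, id_eq] at h1
    rw [← h1, integral_map hZm (measurable_pi_apply p).aestronglyMeasurable]
    exact hX.centered _
  have hK : ∀ p q, ∫ x, x p * x q ∂μ = R p.1 q.1 * S p.2 q.2 := fun p q => by
    rw [integral_map hZm (by fun_prop)]
    exact (hX.covariance _ _).trans (he _ _ _ _)
  have hW : ∀ ω i j, shiftedWishart r e X n d ω i j = wishartMap R (Z ω) (i, j) :=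
    fun ω i j => by
      simp only [shiftedWishart, wishartMap, Matrix.of_apply, Fintype.card_fin, one_div, Z, R]
      rw [Finset.sum_range]
  let Y : Ω' → EuclideanSpace ℝ (Fin n × Fin n) := fun ω => WithLp.toLp 2 fun p => G ω p.1 p.2
  have hY : HasGaussianLaw Y P' := hG.gaussian.toLp_pi 2
  let ν := P'.map Y
  have : IsGaussian ν := hY.isGaussian_map
  have hYm : AEMeasurable Y P' := hY.aemeasurable
  have hν : ∫ z, z ∂ν = 0 := by
    ext p
    have h1 := (EuclideanSpace.proj (𝕜 := ℝ) p).integral_comp_comm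
      (IsGaussian.integrable_id (μ := ν))
    simp only [PiLp.proj_apply, id_eq] at h1
    rw [← h1, integral_map hYm (by fun_prop)]
    exact hG.centered _ _
  have hWT : ∀ a, TemperedC1 (fun x => wishartMap R x a) := fun a =>
    (tempered_wishartMap (τ := Fin d) R).clm_comp (EuclideanSpace.proj (𝕜 := ℝ) a)
  have hWmean : ∀ a, ∫ x, wishartMap R x a ∂μ = 0 := fun a => by
    simp only [wishartMap]
    rw [integral_const_mul, integral_finsetSum _ fun k _ =>
      (((tempered_coord _).mul (tempered_coord _)).sub (.const _)).integrable]
    rw [Finset.sum_eq_zero, mul_zero]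
    intro k _
    rw [integral_sub ((tempered_coord _).mul (tempered_coord _)).integrable
      (integrable_const _), hK]
    simp [S, hs0]
  -- Both matrices are centered, so equality of covariances is equality of second moments.
  have hcov : ∀ a b, ∫ z, z a * z b ∂ν = ∫ x, wishartMap R x a * wishartMap R x b ∂μ :=
    fun a b => by
      have hG2 : ∀ a : Fin n × Fin n, MemLp (fun ω => G ω a.1 a.2) 2 P' := fun a =>
        (hG.gaussian.eval a).memLp_two
      have hW2 : ∀ a : Fin n × Fin n, MemLp (fun x => wishartMap R x a) 2 μ := fun a =>
        (memLp_two_iff_integrable_sq (hWT a).continuous.aestronglyMeasurable).2 <| by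
          simp_rw [pow_two]
          exact ((hWT a).mul (hWT a)).integrable
      have h := hG.covariance a.1 a.2 b.1 b.2
      simp_rw [hW] at h
      rw [covariance_eq_sub (hG2 a) (hG2 b), hG.centered, zero_mul, sub_zero] at h
      have hmap : cov[fun ω => wishartMap R (Z ω) (a.1, a.2),
          fun ω => wishartMap R (Z ω) (b.1, b.2); P] =
          cov[fun x => wishartMap R x a, fun x => wishartMap R x b; μ] :=
        (covariance_map_fun (hWT a).continuous.aestronglyMeasurable
          (hWT b).continuous.aestronglyMeasurable hZm).symm
      rw [hmap, covariance_eq_sub (hW2 a) (hW2 b), hWmean, zero_mul, sub_zero] at h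
      rw [integral_map hYm (by fun_prop)]
      exact h
  refine iSup₂_le fun g hg => ENNReal.ofReal_le_ofReal ?_
  have hgl := lipschitzWith_of_lipNorm_le hg
  have main := abs_integral_wishartMap_sub_le hμ hSs (fun k => by simp [S, hs0]) hR hK hA
    (sum_rpow_shift_le s d) hν hcov hgl
  have e1 : ∫ x, g (Matrix.of fun i j => wishartMap R x (i, j)) ∂μ =
      ∫ ω, g (shiftedWishart r e X n d ω) ∂P := by
    have hm : AEStronglyMeasurable
        (fun x => g (Matrix.of fun i j => wishartMap R x (i, j))) (P.map Z) :=
      (hgl.continuous.comp (tempered_wishartMap R).continuous).aestronglyMeasurable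
    rw [integral_map hZm hm]
    refine integral_congr_ae (ae_of_all _ fun ω => ?_)
    refine congrArg g ?_
    ext i j
    exact (hW ω i j).symm
  have e2 : ∫ z, g (Matrix.of fun i j => z (i, j)) ∂ν = ∫ ω, g (G ω) ∂P' := by
    rw [integral_map hYm hgl.continuous.aestronglyMeasurable]
    rfl
  rw [e1, e2] at main
  refine (le_abs_self _).trans (main.trans_eq ?_)
  simp [rate, A]

end Isonormal

/-! ### From rates to high-dimensional regimes. -/

section Rates

lemma rate_le_rate {s : ℤ → ℝ} {a b : ℝ} (hab : a ≤ b) {n d : ℕ} (hn : 1 ≤ n) :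
    rate s a n d ≤ rate s b n d := by
  have hn' : (1 : ℝ) ≤ n := by exact_mod_cast hn
  have h := Real.rpow_le_rpow_of_exponent_le hn' hab
  have h2 : 0 ≤ ∑ k ∈ Finset.Icc (-(d : ℤ)) (d : ℤ), |s k| ^ (4 / 3 : ℝ) := by positivity
  unfold rate
  gcongr

lemma rate_le_of_memℓp {s : ℤ → ℝ} (hs : Memℓp s (4 / 3)) :
    ∃ K : ℝ, 0 ≤ K ∧ ∀ (a : ℝ) (n d : ℕ),
      rate s a n d ≤ K * ((n : ℝ) ^ a / (d : ℝ) ^ (1 / 4 : ℝ)) := by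
  have hp : ((4 / 3 : ℝ≥0∞)).toReal = 4 / 3 := by
    rw [ENNReal.toReal_div]
    norm_num
  have hsum : Summable fun k => |s k| ^ (4 / 3 : ℝ) := by
    have := hs.summable (by rw [hp]; norm_num)
    simpa only [hp, Real.norm_eq_abs] using this
  refine ⟨(∑' k, |s k| ^ (4 / 3 : ℝ)) ^ (3 / 4 : ℝ), by positivity, fun a n d => ?_⟩
  have h : ∑ k ∈ Finset.Icc (-(d : ℤ)) (d : ℤ), |s k| ^ (4 / 3 : ℝ) ≤
      ∑' k, |s k| ^ (4 / 3 : ℝ) := hsum.sum_le_tsum _ fun _ _ => by positivity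
  have h2 : 0 ≤ ∑ k ∈ Finset.Icc (-(d : ℤ)) (d : ℤ), |s k| ^ (4 / 3 : ℝ) := by positivity
  unfold rate
  rw [mul_comm]
  gcongr

/-- The regime exponent is four times the exponent in the rate: 5/2, 9/4 and 2 correspond to 10, 9
and 8. -/
lemma ofReal_rpow_div_eq (n d m : ℕ) (hd : 1 ≤ d) :
    ENNReal.ofReal ((n : ℝ) ^ ((m : ℝ) / 4) / (d : ℝ) ^ (1 / 4 : ℝ)) =
      ((n : ℝ≥0∞) ^ m / (d : ℝ≥0∞)) ^ (1 / 4 : ℝ) := by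
  have hd' : (0 : ℝ) < d := by exact_mod_cast hd
  have e : (n : ℝ) ^ ((m : ℝ) / 4) / (d : ℝ) ^ (1 / 4 : ℝ) = ((n : ℝ) ^ m / d) ^ (1 / 4 : ℝ) := by
    rw [Real.div_rpow (by positivity) hd'.le, ← Real.rpow_natCast, ← Real.rpow_mul (by positivity)]
    congr 2
    ring
  rw [e, ← ENNReal.ofReal_rpow_of_nonneg (by positivity) (by norm_num),
    ENNReal.ofReal_div_of_pos hd', ENNReal.ofReal_pow (by positivity), ENNReal.ofReal_natCast,
    ENNReal.ofReal_natCast]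

/-- A Wasserstein bound by a multiple of the rate with exponent `m / 4` entails closeness in the
regime `n ^ m / d → 0`. -/
theorem phiClose_of_dWass_le {Ω Ω' : Type*} [MeasurableSpace Ω] [MeasurableSpace Ω']
    {P : Measure Ω} {P' : Measure Ω'} {W : (n d : ℕ) → Ω → Matrix (Fin n) (Fin n) ℝ}
    {G : (n d : ℕ) → Ω' → Matrix (Fin n) (Fin n) ℝ} {s : ℤ → ℝ} (hs : Memℓp s (4 / 3))
    {C : ℝ} (hC : 0 ≤ C) (m : ℕ)
    (h : ∀ n d : ℕ, 1 ≤ n → 1 ≤ d →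
      dWass P (W n d) P' (G n d) ≤ ENNReal.ofReal (C * rate s ((m : ℝ) / 4) n d)) :
    PhiClose (fun n d => (n : ℝ≥0∞) ^ m / (d : ℝ≥0∞)) P W P' G := by
  obtain ⟨K, hK, hrate⟩ := rate_le_of_memℓp hs
  let l : Filter (ℕ × ℕ) := (atTop ×ˢ atTop) ⊓
    comap (fun p : ℕ × ℕ => (p.1 : ℝ≥0∞) ^ m / (p.2 : ℝ≥0∞)) (𝓝 0)
  have hφ : Tendsto (fun p : ℕ × ℕ => (p.1 : ℝ≥0∞) ^ m / (p.2 : ℝ≥0∞)) l (𝓝 0) :=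
    tendsto_comap.mono_left inf_le_right
  have h4 : Tendsto (fun p : ℕ × ℕ => ENNReal.ofReal (C * K) *
      ((p.1 : ℝ≥0∞) ^ m / (p.2 : ℝ≥0∞)) ^ (1 / 4 : ℝ)) l (𝓝 0) := by
    have h5 := hφ.ennrpow_const (1 / 4 : ℝ)
    rw [ENNReal.zero_rpow_of_pos (by norm_num)] at h5
    simpa using ENNReal.Tendsto.const_mul h5 (Or.inr ENNReal.ofReal_ne_top)
  -- The Wasserstein bound is available only for positive dimensions, which holds eventually along
  -- the filter.
  have hev : ∀ᶠ p : ℕ × ℕ in l, 1 ≤ p.1 ∧ 1 ≤ p.2 :=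
    ((eventually_ge_atTop 1).prod_mk (eventually_ge_atTop 1)).filter_mono inf_le_left
  refine tendsto_of_tendsto_of_tendsto_of_le_of_le' tendsto_const_nhds h4
    (.of_forall fun _ => zero_le) ?_
  filter_upwards [hev] with p hp
  refine (dFM_le_dWass P _ P' _).trans ((h p.1 p.2 hp.1 hp.2).trans ?_)
  rw [← ofReal_rpow_div_eq _ _ _ hp.2, ← ENNReal.ofReal_mul (by positivity)]
  refine ENNReal.ofReal_le_ofReal ?_
  rw [mul_assoc]
  exact mul_le_mul_of_nonneg_left (hrate _ _ _) hC

end Rates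

end CorrelatedWishart

theorem mainTheorem6 :
    -- `C` is absolute, while `C₂ r` and `C₁ r` depend on `r` only
    ∃ (C : ℝ) (C₂ C₁ : (ℤ → ℝ) → ℝ),
    ∀ {H Ω Ω' : Type*} [NormedAddCommGroup H] [InnerProductSpace ℝ H] [CompleteSpace H]
      [TopologicalSpace.SeparableSpace H] [MeasurableSpace Ω] [MeasurableSpace Ω']
      (P : Measure Ω) [IsProbabilityMeasure P] (P' : Measure Ω') [IsProbabilityMeasure P']
      (r s : ℤ → ℝ) (e : ℕ → ℕ → H) (X : H → Ω → ℝ)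
      (G : (n d : ℕ) → Ω' → Matrix (Fin n) (Fin n) ℝ)
      (_hs : Memℓp s 2) (_hr0 : r 0 = 1) (_hs0 : s 0 = 1)
      (_he : ∀ i j i' j' : ℕ,
        inner ℝ (e i j) (e i' j') = r ((i : ℤ) - (i' : ℤ)) * s ((j : ℤ) - (j' : ℤ)))
      (_hX : CorrelatedWishart.IsIsonormal X P)
      (_hG : ∀ n d : ℕ, 1 ≤ n → 1 ≤ d → CorrelatedWishart.IsGaussianCounterpart P' (G n d) P
        (CorrelatedWishart.shiftedWishart r e X n d)),
      -- bounds in Wasserstein distance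
      (∀ n d : ℕ, 1 ≤ n → 1 ≤ d →
        CorrelatedWishart.dWass P (CorrelatedWishart.shiftedWishart r e X n d) P' (G n d)
          ≤ ENNReal.ofReal (C * CorrelatedWishart.rate s (5 / 2) n d)) ∧
      (Memℓp r 2 → ∀ n d : ℕ, 1 ≤ n → 1 ≤ d →
        CorrelatedWishart.dWass P (CorrelatedWishart.shiftedWishart r e X n d) P' (G n d)
          ≤ ENNReal.ofReal (C₂ r * CorrelatedWishart.rate s (9 / 4) n d)) ∧
      (Memℓp r 1 → ∀ n d : ℕ, 1 ≤ n → 1 ≤ d →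
        CorrelatedWishart.dWass P (CorrelatedWishart.shiftedWishart r e X n d) P' (G n d)
          ≤ ENNReal.ofReal (C₁ r * CorrelatedWishart.rate s 2 n d)) ∧
      -- high-dimensional regimes
      (Memℓp s (4 / 3) →
        CorrelatedWishart.PhiClose (fun n d => (n : ℝ≥0∞) ^ 10 / (d : ℝ≥0∞))
          P (CorrelatedWishart.shiftedWishart r e X) P' G ∧
        (Memℓp r 2 →
          CorrelatedWishart.PhiClose (fun n d => (n : ℝ≥0∞) ^ 9 / (d : ℝ≥0∞))
            P (CorrelatedWishart.shiftedWishart r e X) P' G) ∧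
        (Memℓp r 1 →
          CorrelatedWishart.PhiClose (fun n d => (n : ℝ≥0∞) ^ 8 / (d : ℝ≥0∞))
            P (CorrelatedWishart.shiftedWishart r e X) P' G)) := by
  -- The bound with exponent 2 has constant 8 whatever `r` is, and for $n\ge1$ it dominates nothing
  -- but itself: the rates with exponents 9/4 and 5/2 are larger.
  refine ⟨8, fun _ => 8, fun _ => 8, ?_⟩
  intro H Ω Ω' _ _ _ _ _ _ P _ P' _ r s e X G _ hr0 hs0 he hX hG
  have key : ∀ a : ℝ, 2 ≤ a → ∀ n d : ℕ, 1 ≤ n → 1 ≤ d →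
      CorrelatedWishart.dWass P (CorrelatedWishart.shiftedWishart r e X n d) P' (G n d)
        ≤ ENNReal.ofReal (8 * CorrelatedWishart.rate s a n d) := fun a ha n d hn hd =>
    (CorrelatedWishart.dWass_shiftedWishart_le hr0 hs0 he hX hn hd (hG n d hn hd)).trans
      (ENNReal.ofReal_le_ofReal (mul_le_mul_of_nonneg_left
        (CorrelatedWishart.rate_le_rate ha hn) (by norm_num)))
  have close : Memℓp s (4 / 3) → ∀ m : ℕ, 8 ≤ m →
      CorrelatedWishart.PhiClose (fun n d => (n : ℝ≥0∞) ^ m / (d : ℝ≥0∞))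
        P (CorrelatedWishart.shiftedWishart r e X) P' G := fun hs m hm => by
    refine CorrelatedWishart.phiClose_of_dWass_le hs (by norm_num : (0 : ℝ) ≤ 8) m
      (key _ ?_)
    have : (8 : ℝ) ≤ m := by exact_mod_cast hm
    linarith
  exact ⟨key _ (by norm_num), fun _ => key _ (by norm_num), fun _ => key _ le_rfl,
    fun hs => ⟨close hs 10 (by norm_num), fun _ => close hs 9 (by norm_num),
      fun _ => close hs 8 le_rfl⟩⟩
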